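/- Let $\mathbb R^{1,n}$ carry the form $\langle x,y\rangle=-x_0y_0+x_1y_1+\dots+x_ny_n$, and let $\mathrm{dS}_3=\{x\in\mathbb R^{1,3}:\langle x,x\rangle=1\}$ and $\mathbb H^3_\pm=\{x\in\mathbb R^{1,3}:\langle x,x\rangle=-1\}$. Let $\mathcal L\subset\mathbb R^{1,4}$ be the light cone and $\mathbb P\mathcal L$ its projectivization. It is identified with the round sphere $\mathbb S^3=\{x\in\mathcal L:x_0=1\}$ by $[x]\mapsto x/x_0$; the spherical lift of a map $f$ into $\mathbb P\mathcal L$ is denoted $f_{\mathrm{sph}}$. Put $\mathbb S^2_{\mathrm{eq}}=\{x\in\mathbb S^3:x_4=0\}$. Where $f_{\mathrm{sph}}\notin\mathbb S^2_{\mathrm{eq}}$, the map $f$ has the hyperbolic lift $f_{\mathrm{hyp}}=(x_0/x_4,\dots,x_3/x_4)\in\mathbb H^3_\pm$, with $f=[x]$. **Definitions.** Let $M$ be a Riemann surface. A smooth map $f\colon M\to\mathbb P\mathcal L$ is *harmonic* if $f_{\mathrm{hyp}}$ is a harmonic map into $\mathbb H^3_\pm$ on the set where it is defined. It is *transgressive*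 if at every $x\in f_{\mathrm{sph}}^{-1}(\mathbb S^2_{\mathrm{eq}})$ 1. the conformally invariant Hopf differential $\langle\partial\hat f,\partial\hat f\rangle\otimes\hat f^{-2}$ ($\hat f$ any local lift of $f$ to $\mathcal L\setminus\{0\}$) vanishes, and 2. there is $v\in T_xM$ with $d_xf_{\mathrm{sph}}v\ne0$ and $d_xf_{\mathrm{sph}}v\perp T_{f_{\mathrm{sph}}(x)}\mathbb S^2_{\mathrm{eq}}$. **Theorem.** Let $N\colon M\to\mathrm{dS}_3$ be a smooth harmonic map whose Hopf differential is $Q=\langle\partial N,\partial N\rangle=-\omega^2$ for a smooth $(1,0)$-form $\omega$ on $M$. Let $\Gamma\subset M$ be a one-dimensional submanifold containing no zeros of $Q$, and suppose that $N|_{M\setminus\Gamma}$ is an immersion, that $\operatorname{rank}dN\le1$ along $\Gamma$, and that the rank drops transversally without signature change, i.e. every point of $M$ has a neighbourhood $U$ with smooth real coordinates $(x_1,x_2)$ and a smooth function $d\colon U\to\mathbb R$ without critical points such that $\Gamma\cap U=d^{-1}(0)$ and, with one fixed sign on $U$, $$d^2=\pm\det\Bigl(\bigl\langle\tfrac{\partial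 N}{\partial x_i},\tfrac{\partial N}{\partial x_j}\bigr\rangle\Bigr)_{i,j}.$$ (In particular the metric induced by $N$ is nondegenerate on $M\setminus\Gamma$.) Then there is a transgressive harmonic map $f\colon M\to\mathbb P\mathcal L$ such that $f_{\mathrm{sph}}^{-1}(\mathbb S^2_{\mathrm{eq}})\subset\Gamma$ and such that on $M\setminus\Gamma$ the map $f_{\mathrm{hyp}}$ is the dual of $N$ with respect to $\omega$, that is, $$\langle N,f_{\mathrm{hyp}}\rangle=0,\qquad\langle dN,f_{\mathrm{hyp}}\rangle=-(\omega+\overline\omega),\qquad\langle f_{\mathrm{hyp}},f_{\mathrm{hyp}}\rangle=-1,\qquad\det(N,f_{\mathrm{hyp}},N_x,N_y)>0$$ for every local holomorphic coordinate $x+iy$ on $M$. -/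

import Mathlib

open scoped Manifold ContDiff

noncomputable section

/-- The Minkowski form `-x₀y₀ + x₁y₁ + … + xₙyₙ` on `ℝ^{1,n}`; for `R = ℂ` it is the complex
bilinear extension of the real one. -/
def mink {R : Type*} [CommRing R] {n : ℕ} (x y : Fin (n + 1) → R) : R :=
  -(x 0 * y 0) + ∑ i : Fin n, x i.succ * y i.succ

/-- De Sitter space `dS₃ ⊂ ℝ^{1,3}`. -/
def deSitter : Set (Fin 4 → ℝ) := {x | mink x x = 1}

/-- The two-sheeted hyperboloid `ℍ³₊ ∪ ℍ³₋ ⊂ ℝ^{1,3}`. -/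
def hyperboloid : Set (Fin 4 → ℝ) := {x | mink x x = -1}

/-- The light cone of `ℝ^{1,4}`. -/
def lightCone : Set (Fin 5 → ℝ) := {x | mink x x = 0}

/-- `ℙℒ`: the lines of `ℝ^{1,4}` that lie in the light cone. -/
def ProjLightCone : Type :=
  {ℓ : Projectivization ℝ (Fin 5 → ℝ) // ∀ v ∈ ℓ.submodule, v ∈ lightCone}

/-- The point of `ℙℒ` that a nonzero light-like vector represents. -/
def ProjLightCone.mk (v : Fin 5 → ℝ) (hv : v ≠ 0) (h : v ∈ lightCone) : ProjLightCone :=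
  ⟨Projectivization.mk ℝ v hv, by
    intro w hw
    rw [Projectivization.submodule_mk, Submodule.mem_span_singleton] at hw
    obtain ⟨a, rfl⟩ := hw
    have h0 : mink v v = 0 := h
    have h1 : mink (a • v) (a • v) = a * a * mink v v := by
      simp only [mink, Pi.smul_apply, smul_eq_mul, mul_add, Finset.mul_sum]
      congr 1
      · ring
      · exact Finset.sum_congr rfl fun i _ => by ring
    change mink (a • v) (a • v) = 0
    rw [h1, h0, mul_zero]⟩

/-- The round sphere `𝕊³ = {x ∈ ℒ : x₀ = 1}`. -/
def roundSphere : Set (Fin 5 → ℝ) := {x | x ∈ lightCone ∧ x 0 = 1}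

/-- The equatorial sphere `𝕊²_eq = {x ∈ 𝕊³ : x₄ = 0}`. -/
def equatorialSphere : Set (Fin 5 → ℝ) := {x | x ∈ roundSphere ∧ x 4 = 0}

/-- The tangent space `T_p 𝕊²_eq`, as a set of vectors of `ℝ^{1,4}`. -/
def equatorialTangent (p : Fin 5 → ℝ) : Set (Fin 5 → ℝ) :=
  {w | w 0 = 0 ∧ w 4 = 0 ∧ mink p w = 0}

/-- The section `[x₀ : … : x₄] ↦ (1, x₁/x₀, …, x₄/x₀)`, which identifies `ℙℒ` with `𝕊³`. -/
def sphSection (ℓ : ProjLightCone) : Fin 5 → ℝ := fun i => ℓ.1.rep i / ℓ.1.rep 0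

/-- The section `[x₀ : … : x₄] ↦ (x₀/x₄, …, x₃/x₄, 1)` over `{x₄ ≠ 0}`, with the last coordinate
dropped. -/
def hypSection (ℓ : ProjLightCone) : Fin 4 → ℝ := fun i => ℓ.1.rep i.castSucc / ℓ.1.rep 4

/-- The sections do not depend on the representing vector. -/
theorem sphSection_mk (v : Fin 5 → ℝ) (hv : v ≠ 0) (h : v ∈ lightCone) :
    sphSection (ProjLightCone.mk v hv h) = fun i => v i / v 0 := by
  obtain ⟨a, ha⟩ := Projectivization.exists_smul_eq_mk_rep ℝ v hv
  funext i
  simp only [sphSection, ProjLightCone.mk, ← ha, Pi.smul_apply, Units.smul_def, smul_eq_mul]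
  exact mul_div_mul_left _ _ a.ne_zero

theorem hypSection_mk (v : Fin 5 → ℝ) (hv : v ≠ 0) (h : v ∈ lightCone) :
    hypSection (ProjLightCone.mk v hv h) = fun i => v i.castSucc / v 4 := by
  obtain ⟨a, ha⟩ := Projectivization.exists_smul_eq_mk_rep ℝ v hv
  funext i
  simp only [hypSection, ProjLightCone.mk, ← ha, Pi.smul_apply, Units.smul_def, smul_eq_mul]
  exact mul_div_mul_left _ _ a.ne_zero

/-- For `F` defined on a domain of `ℂ` (the coordinate expression of a map), the vector
`∂F/∂z = (F_x - i F_y) / 2`. -/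
def dz {n : ℕ} (F : ℂ → Fin n → ℝ) (z : ℂ) : Fin n → ℂ := fun i =>
  ((fderiv ℝ F z 1 i : ℂ) - Complex.I * (fderiv ℝ F z Complex.I i : ℂ)) / 2

/-- The coefficient `⟨∂F/∂z, ∂F/∂z⟩` of the Hopf differential `⟨∂F, ∂F⟩` at `dz²`. -/
def hopf {n : ℕ} (F : ℂ → Fin (n + 1) → ℝ) (z : ℂ) : ℂ := mink (dz F z) (dz F z)

/-- The Gram determinant `det (⟨∂F/∂xᵢ, ∂F/∂xⱼ⟩)` in the real coordinates `x₁ + i x₂`. -/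
def gramDet {n : ℕ} (F : ℂ → Fin (n + 1) → ℝ) (z : ℂ) : ℝ :=
  Matrix.det !![mink (fderiv ℝ F z 1) (fderiv ℝ F z 1),
                  mink (fderiv ℝ F z 1) (fderiv ℝ F z Complex.I);
                mink (fderiv ℝ F z Complex.I) (fderiv ℝ F z 1),
                  mink (fderiv ℝ F z Complex.I) (fderiv ℝ F z Complex.I)]

section Surface

variable {M : Type*} [TopologicalSpace M] [ChartedSpace ℂ M]

variable (M) in
/-- A smooth `(1,0)`-form on a Riemann surface, equal to `coeff φ · dz` in the holomorphic chart
`φ = z`. -/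
structure OneZeroForm where
  coeff : OpenPartialHomeomorph M ℂ → ℂ → ℂ
  smooth : ∀ φ ∈ atlas ℂ M, ContDiffOn ℝ ∞ (coeff φ) φ.target
  change_coord : ∀ φ ∈ atlas ℂ M, ∀ ψ ∈ atlas ℂ M, ∀ z ∈ φ.target, φ.symm z ∈ ψ.source →
    coeff φ z = coeff ψ (ψ (φ.symm z)) * deriv (ψ ∘ φ.symm) z

/-- Harmonicity, over the open set `S ⊂ M`, of a map `F` into a quadric
`{y : ⟨y, y⟩ = c}`, `c ≠ 0`, of `ℝ^{1,n}`: in holomorphic coordinates, the component of the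
Laplacian `F_xx + F_yy` tangent to the quadric (a multiple of the tension field) vanishes, that is,
the Laplacian is a multiple of the normal vector `F`. -/
def IsHarmonicQuadricMapOn {n : ℕ} (F : M → Fin (n + 1) → ℝ) (S : Set M) : Prop :=
  ∀ φ ∈ atlas ℂ M, ∀ z ∈ φ.target, φ.symm z ∈ S →
    ∃ μ : ℝ, Laplacian.laplacian (F ∘ φ.symm) z = μ • F (φ.symm z)

/-- `Q = -α²` for the Hopf differential `Q` of `N`. -/
def HopfEqNegSq (N : M → Fin 4 → ℝ) (α : OneZeroForm M) : Prop :=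
  ∀ φ ∈ atlas ℂ M, ∀ z ∈ φ.target, hopf (N ∘ φ.symm) z = -(α.coeff φ z) ^ 2

/-- `N` is an immersion off `Γ`, and its rank drops along the curve `Γ` transversally without
signature change. The local equations `d = 0` make `Γ` a one-dimensional submanifold. -/
structure RankDropsTransversally (N : M → Fin 4 → ℝ) (Γ : Set M) : Prop where
  immersion : ∀ φ ∈ atlas ℂ M, ∀ z ∈ φ.target, φ.symm z ∉ Γ →
    Function.Injective (fderiv ℝ (N ∘ φ.symm) z)
  rank_le : ∀ φ ∈ atlas ℂ M, ∀ z ∈ φ.target, φ.symm z ∈ Γ →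
    Module.finrank ℝ (LinearMap.range (fderiv ℝ (N ∘ φ.symm) z).toLinearMap) ≤ 1
  defining_function : ∀ p : M, ∃ φ ∈ IsManifold.maximalAtlas 𝓘(ℝ, ℂ) ∞ M, p ∈ φ.source ∧
    ∃ d : ℂ → ℝ, ContDiffOn ℝ ∞ d φ.target ∧
      (∀ z ∈ φ.target, fderiv ℝ d z ≠ 0) ∧
      (∀ z ∈ φ.target, φ.symm z ∈ Γ ↔ d z = 0) ∧
      ∃ ε : ℝ, (ε = 1 ∨ ε = -1) ∧ ∀ z ∈ φ.target, d z ^ 2 = ε * gramDet (N ∘ φ.symm) z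

/-- `f` is, over the open set `S` on which `N` is an immersion, the dual map of `N` with respect to
`α`: `f` is tangent to `dS₃` at `N`, `⟨dN, f⟩ = -(α + ᾱ)`, `⟨f, f⟩ = -1` and
`det (N, f, N_x, N_y) > 0`. -/
structure IsDualMapOn (N : M → Fin 4 → ℝ) (α : OneZeroForm M) (f : M → Fin 4 → ℝ) (S : Set M) :
    Prop where
  tangent : ∀ p ∈ S, mink (N p) (f p) = 0
  pairing : ∀ φ ∈ atlas ℂ M, ∀ z ∈ φ.target, φ.symm z ∈ S → ∀ v : ℂ,
    ((mink (fderiv ℝ (N ∘ φ.symm) z v) (f (φ.symm z)) : ℝ) : ℂ) =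
      -(α.coeff φ z * v + starRingEnd ℂ (α.coeff φ z * v))
  mem_hyperboloid : ∀ p ∈ S, f p ∈ hyperboloid
  oriented : ∀ φ ∈ atlas ℂ M, ∀ z ∈ φ.target, φ.symm z ∈ S →
    0 < Matrix.det (Matrix.of ![N (φ.symm z), f (φ.symm z),
      fderiv ℝ (N ∘ φ.symm) z 1, fderiv ℝ (N ∘ φ.symm) z Complex.I])

/-- A map into `ℙℒ ≅ 𝕊³` is smooth if its spherical lift is. -/
def IsSmoothProj (f : M → ProjLightCone) : Prop :=
  ContMDiff 𝓘(ℝ, ℂ) 𝓘(ℝ, Fin 5 → ℝ) ∞ (sphSection ∘ f)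

/-- `f` is transgressive: smooth, conformal at infinity, and orthogonal to `𝕊²_eq` along
`f_sph⁻¹(𝕊²_eq)`. The conformally invariant Hopf differential `⟨∂f̂, ∂f̂⟩ ⊗ f̂⁻²` does not depend on
the lift `f̂` of `f`; the spherical lift is used, whose coefficient is `hopf`. -/
structure IsTransgressive (f : M → ProjLightCone) : Prop where
  smooth : IsSmoothProj f
  conformal : ∀ φ ∈ atlas ℂ M, ∀ z ∈ φ.target, sphSection (f (φ.symm z)) ∈ equatorialSphere →
    hopf (sphSection ∘ f ∘ φ.symm) z = 0
  orthogonal : ∀ φ ∈ atlas ℂ M, ∀ z ∈ φ.target, sphSection (f (φ.symm z)) ∈ equatorialSphere →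
    ∃ v : ℂ, fderiv ℝ (sphSection ∘ f ∘ φ.symm) z v ≠ 0 ∧
      ∀ w ∈ equatorialTangent (sphSection (f (φ.symm z))),
        mink (fderiv ℝ (sphSection ∘ f ∘ φ.symm) z v) w = 0

/-- `f` is harmonic: its hyperbolic lift, defined where `f` does not meet `𝕊²_eq`, is harmonic into
`ℍ³₊ ∪ ℍ³₋`. -/
def IsHarmonicProj (f : M → ProjLightCone) : Prop :=
  IsHarmonicQuadricMapOn (hypSection ∘ f) {p | sphSection (f p) ∉ equatorialSphere}

end Surface

end

/-!
In a holomorphic coordinate `z`, write `ω = a dz` and `h = ⟨∂N, ∂̄N⟩`. The Gram determinant of `N`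
is `4 (h - |a|²) (h + |a|²)`, and solving the linear and quadratic equations for the dual map `f`
off the curve gives `f = (-(ā ∂N + a ∂̄N) + (s / 2) n) / (h - |a|²)`, where `n` is the cross
product of `N, N_x, N_y` and `s` is the sign of `h + |a|²`, chosen so that
`det (N, f, N_x, N_y) > 0`. Numerator and denominator together form a light-like vector of
`ℝ^{1,4}`, the `dualLift`, which a holomorphic coordinate change with derivative `c` multiplies by
`|c|²` (`dualLift_change`).

On the curve one of the factors `h ∓ |a|²` vanishes, and only one, because `a ≠ 0` there. If
`h + |a|² = 0`, the dual lift does not vanish, and `s` is locally constant off the curve because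
`±d² = 4 (h - |a|²) (h + |a|²)` has a constant sign; so `f` extends smoothly into the hyperboloid.
If `h = |a|²`, the condition on the rank makes the dual lift vanish along the curve. By Hadamard's
lemma (`exists_contDiffOn_eq_mul`) its quotient by `d` is smooth; it is nonzero because the normal
part `n / d` satisfies `⟨n / d, n / d⟩ = ∓1`, and its last component is a unit times `d`, so that
it meets `x₄ = 0` transversally. The outcome is `exists_isDualLiftOn`. As the complement of the
curve is dense, these local lifts fit together to the continuous extension of the dual map
(`exists_isDualLiftOn_chart`).

Where the lift `(X, τ)` has `τ = 0`, one has `N_x = 2 (Im a) e` and `N_y = 2 (Re a) e` for a unit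
vector `e`. Differentiating the relations `⟨X, ∂N⟩ = -a τ`, `⟨X, N⟩ = 0`, `⟨X, X⟩ = -τ²` and using
that `ΔN` is a multiple of `N`, one finds that `X_x - τ_y e` and `X_y + τ_x e` are multiples of
`X` (`IsDualLiftOn.exists_fderiv_eq`). Hence the spherical lift is conformal at such a point, and
its derivative along the gradient of `τ` is normal to the equator.

For harmonicity, `a` is holomorphic since `a²` is. Off the curve, differentiating the relations
between `f` and `N` shows that `∂f` is orthogonal to `f` and `∂̄N`, hence equal to `a N + κ u`
with the isotropic vector `u = ∂̄N - ā f`, and the harmonic map equation for `f` reduces to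
`⟨∂f, ∂̄u⟩ = 0` (`HarmonicPatch.laplacian_dual`). By density it also holds at the points of the
curve where `f` is finite.
-/

noncomputable section

/-! ### Hadamard's lemma along a curve -/

/-- Smoothness of a parametric integral, by iterated differentiation under the integral sign. The
target space is quantified inside the induction because the derivative takes values in another
space. -/
theorem contDiff_nat_intervalIntegral_param {E : Type} [NormedAddCommGroup E] [NormedSpace ℝ E]
    [FiniteDimensional ℝ E] (n : ℕ) :
    ∀ {F : Type} [NormedAddCommGroup F] [NormedSpace ℝ F] [CompleteSpace F] {H : E × ℝ → F},
      ContDiff ℝ ∞ H → ContDiff ℝ n fun x => ∫ s in (0 : ℝ)..1, H (x, s) := by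
  induction n with
  | zero =>
    intro F _ _ _ H hH
    refine contDiff_zero.2 ?_
    exact intervalIntegral.continuous_parametric_intervalIntegral_of_continuous'
      (f := fun x s => H (x, s)) hH.continuous 0 1
  | succ n ih =>
    intro F _ _ _ H hH
    set H' : E × ℝ → E →L[ℝ] F := fun q =>
      (fderiv ℝ H q).comp (ContinuousLinearMap.inl ℝ E ℝ) with hH'
    have hH's : ContDiff ℝ ∞ H' :=
      (hH.fderiv_right (m := ∞) le_rfl).clm_comp contDiff_const
    have hder : ∀ x, HasFDerivAt (fun x => ∫ s in (0 : ℝ)..1, H (x, s))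
        (∫ s in (0 : ℝ)..1, H' (x, s)) x := by
      intro x
      have hK : IsCompact (Metric.closedBall x 1 ×ˢ Set.Icc (0 : ℝ) 1) :=
        (isCompact_closedBall x 1).prod isCompact_Icc
      obtain ⟨C, hC⟩ := hK.exists_bound_of_continuousOn (f := H') hH's.continuous.continuousOn
      refine (intervalIntegral.hasFDerivAt_integral_of_dominated_of_fderiv_le
        (F := fun x s => H (x, s)) (F' := fun x s => H' (x, s)) (bound := fun _ => C)
        (s := Metric.ball x 1) (Metric.ball_mem_nhds x one_pos) ?_ ?_ ?_ ?_ ?_ ?_)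
      · exact Filter.Eventually.of_forall fun y =>
          (hH.continuous.comp (Continuous.prodMk_right y)).aestronglyMeasurable
      · exact (hH.continuous.comp (Continuous.prodMk_right x)).intervalIntegrable 0 1
      · exact (hH's.continuous.comp (Continuous.prodMk_right x)).aestronglyMeasurable
      · refine Filter.Eventually.of_forall fun s hs y hy => hC (y, s) ⟨?_, ?_⟩
        · exact Metric.ball_subset_closedBall hy
        · rw [Set.uIoc_of_le zero_le_one] at hs
          exact ⟨hs.1.le, hs.2⟩
      · exact intervalIntegrable_const
      · refine Filter.Eventually.of_forall fun s _ y _ => ?_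
        have h1 : HasFDerivAt H (fderiv ℝ H (y, s)) (y, s) :=
          (hH.differentiable (by simp) (y, s)).hasFDerivAt
        exact h1.comp y (hasFDerivAt_prodMk_left y s)
    rw [show ((n + 1 : ℕ) : WithTop ℕ∞) = (n : WithTop ℕ∞) + 1 by norm_cast]
    refine contDiff_succ_iff_fderiv.2 ⟨fun x => (hder x).differentiableAt, by simp, ?_⟩
    have : fderiv ℝ (fun x => ∫ s in (0 : ℝ)..1, H (x, s)) =
        fun x => ∫ s in (0 : ℝ)..1, H' (x, s) := funext fun x => (hder x).fderiv
    rw [this]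
    exact ih hH's

theorem contDiff_intervalIntegral_param {E F : Type} [NormedAddCommGroup E] [NormedSpace ℝ E]
    [FiniteDimensional ℝ E] [NormedAddCommGroup F] [NormedSpace ℝ F] [CompleteSpace F]
    {H : E × ℝ → F} (hH : ContDiff ℝ ∞ H) :
    ContDiff ℝ ∞ fun x => ∫ s in (0 : ℝ)..1, H (x, s) :=
  contDiff_infty.2 fun n => contDiff_nat_intervalIntegral_param n hH

/-- Hadamard's lemma in straightened coordinates: a smooth function of `(t, y)` that vanishes on
the axis `t = 0` is divisible by `t`. -/
theorem exists_contDiff_eq_fst_mul {h : ℝ × ℝ → ℝ} (hh : ContDiff ℝ ∞ h)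
    (h0 : ∀ y, h (0, y) = 0) : ∃ k : ℝ × ℝ → ℝ, ContDiff ℝ ∞ k ∧ ∀ q, h q = q.1 * k q := by
  set H : (ℝ × ℝ) × ℝ → ℝ := fun r => fderiv ℝ h (r.2 * r.1.1, r.1.2) (1, 0) with hHdef
  have hH : ContDiff ℝ ∞ H := by
    have h1 : ContDiff ℝ ∞ (fderiv ℝ h) := hh.fderiv_right (m := ∞) le_rfl
    have h2 : ContDiff ℝ ∞ (fun r : (ℝ × ℝ) × ℝ => (r.2 * r.1.1, r.1.2)) := by fun_prop
    exact (h1.comp h2).clm_apply contDiff_const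
  refine ⟨_, contDiff_intervalIntegral_param hH, ?_⟩
  rintro ⟨t, y⟩
  have hd : ∀ s ∈ Set.uIcc (0 : ℝ) 1, HasDerivAt (fun s => h (s * t, y)) (t * H ((t, y), s)) s := by
    intro s _
    have e1 : HasFDerivAt h (fderiv ℝ h (s * t, y)) (s * t, y) :=
      (hh.differentiable (by simp) _).hasFDerivAt
    have e2 : HasDerivAt (fun s : ℝ => (s * t, y)) (t, (0 : ℝ)) s := by
      have := (hasDerivAt_id s).mul_const t
      simpa using this.prodMk (hasDerivAt_const s y)
    have e3 := e1.comp_hasDerivAt s e2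
    have e4 : ((t, 0) : ℝ × ℝ) = t • ((1, 0) : ℝ × ℝ) := by simp
    rw [e4, map_smul] at e3
    exact e3
  have hc : Continuous fun s => t * H ((t, y), s) :=
    continuous_const.mul (hH.continuous.comp (Continuous.prodMk_right (t, y)))
  have := intervalIntegral.integral_eq_sub_of_hasDerivAt hd (hc.intervalIntegrable 0 1)
  rw [intervalIntegral.integral_const_mul] at this
  simp only [one_mul, zero_mul, h0, sub_zero] at this
  exact this.symm

theorem clm_complex_apply {F : Type*} [NormedAddCommGroup F] [NormedSpace ℝ F] (A : ℂ →L[ℝ] F)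
    (v : ℂ) : A v = v.re • A 1 + v.im • A Complex.I := by
  conv_lhs => rw [← Complex.re_add_im v]
  have : (v.re : ℂ) + v.im * Complex.I = v.re • (1 : ℂ) + v.im • Complex.I := by simp
  rw [this, map_add, map_smul, map_smul]

/-- Hadamard's lemma along a regular curve: near a point of `d = 0` where `d` is regular, a smooth
function vanishing on the curve is divisible by `d`. The curve is straightened by taking `d` as the
first coordinate. -/
theorem exists_contDiffOn_eq_mul {U : Set ℂ} (hU : IsOpen U) {d g : ℂ → ℝ}
    (hd : ContDiffOn ℝ ∞ d U) (hg : ContDiffOn ℝ ∞ g U) {z₀ : ℂ} (hz₀ : z₀ ∈ U)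
    (hd' : fderiv ℝ d z₀ ≠ 0) (hgd : ∀ z ∈ U, d z = 0 → g z = 0) :
    ∃ V : Set ℂ, IsOpen V ∧ z₀ ∈ V ∧ V ⊆ U ∧ ∃ k : ℂ → ℝ, ContDiffOn ℝ ∞ k V ∧
      ∀ z ∈ V, g z = d z * k z := by
  set A := fderiv ℝ d z₀ 1 with hA
  set B := fderiv ℝ d z₀ Complex.I with hB
  have hAB : 0 < A ^ 2 + B ^ 2 := by
    by_contra hcon
    apply hd'
    have hA0 : A = 0 := by nlinarith [sq_nonneg A, sq_nonneg B]
    have hB0 : B = 0 := by nlinarith [sq_nonneg A, sq_nonneg B]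
    ext v
    rw [clm_complex_apply, ← hA, ← hB, hA0, hB0]
    simp
  have hfd : ContinuousOn (fderiv ℝ d) U :=
    hd.continuousOn_fderiv_of_isOpen hU (by simp)
  -- the part of `U` on which `d` increases in the direction of its gradient at `z₀`
  set U' : Set ℂ := U ∩ {z | 0 < A * fderiv ℝ d z 1 + B * fderiv ℝ d z Complex.I} with hU'def
  have hU' : IsOpen U' := by
    have : ContinuousOn (fun z => A * fderiv ℝ d z 1 + B * fderiv ℝ d z Complex.I) U := by
      have c1 : ContinuousOn (fun z => fderiv ℝ d z 1) U := hfd.clm_apply continuousOn_const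
      have c2 : ContinuousOn (fun z => fderiv ℝ d z Complex.I) U := hfd.clm_apply continuousOn_const
      exact (continuousOn_const.mul c1).add (continuousOn_const.mul c2)
    exact this.isOpen_inter_preimage hU isOpen_Ioi
  have hz₀' : z₀ ∈ U' := ⟨hz₀, by
    change 0 < A * A + B * B
    nlinarith⟩
  set l : ℂ →L[ℝ] ℝ := (-B) • Complex.reCLM + A • Complex.imCLM with hl
  set Φ : ℂ → ℝ × ℝ := fun z => (d z, l z) with hΦ
  have hΦs : ContDiffOn ℝ ∞ Φ U := hd.prodMk l.contDiff.contDiffOn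
  have hΦd : ∀ z ∈ U', ∃ e : ℂ ≃L[ℝ] ℝ × ℝ, HasFDerivAt Φ (e : ℂ →L[ℝ] ℝ × ℝ) z := by
    intro z hz
    have hinj : Function.Injective ((fderiv ℝ d z).prod l : ℂ →L[ℝ] ℝ × ℝ).toLinearMap := by
      refine (injective_iff_map_eq_zero _).2 fun v hv => ?_
      have hv' : (fderiv ℝ d z v, l v) = ((0 : ℝ), (0 : ℝ)) := hv
      obtain ⟨h1, h2⟩ := Prod.mk.inj hv'
      rw [clm_complex_apply, smul_eq_mul, smul_eq_mul] at h1
      have h2' : -B * v.re + A * v.im = 0 := by simpa [hl] using h2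
      have hpos : 0 < A * fderiv ℝ d z 1 + B * fderiv ℝ d z Complex.I := hz.2
      have hre : v.re * (A * fderiv ℝ d z 1 + B * fderiv ℝ d z Complex.I) = 0 := by
        linear_combination A * h1 - fderiv ℝ d z Complex.I * h2'
      have him : v.im * (A * fderiv ℝ d z 1 + B * fderiv ℝ d z Complex.I) = 0 := by
        linear_combination B * h1 + fderiv ℝ d z 1 * h2'
      exact Complex.ext ((mul_eq_zero.1 hre).resolve_right hpos.ne')
        ((mul_eq_zero.1 him).resolve_right hpos.ne')
    have hfr : Module.finrank ℝ ℂ = Module.finrank ℝ (ℝ × ℝ) := by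
      simp [Complex.finrank_real_complex]
    refine ⟨(LinearEquiv.ofInjectiveOfFinrankEq _ hinj hfr).toContinuousLinearEquiv, ?_⟩
    have h1 : HasFDerivAt d (fderiv ℝ d z) z :=
      ((hd.contDiffAt (hU.mem_nhds hz.1)).differentiableAt (by simp)).hasFDerivAt
    have h2 := h1.prodMk (l.hasFDerivAt (x := z))
    exact h2.congr_fderiv (ContinuousLinearMap.ext fun v => rfl)
  obtain ⟨e₀, he₀⟩ := hΦd z₀ hz₀'
  set T := (hΦs.contDiffAt (hU.mem_nhds hz₀)).toOpenPartialHomeomorph Φ he₀ (by simp) with hT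
  have hTc : ∀ z, T z = Φ z := fun z => rfl
  have hzT : z₀ ∈ T.source := ContDiffAt.mem_toOpenPartialHomeomorph_source _ he₀ _
  set W : Set (ℝ × ℝ) := T.target ∩ T.symm ⁻¹' U' with hW
  have hWo : IsOpen W := T.symm.isOpen_inter_preimage hU'
  have hΦW : Φ z₀ ∈ W := by
    refine ⟨T.map_source hzT, ?_⟩
    change T.symm (T z₀) ∈ U'
    rw [T.left_inv hzT]
    exact hz₀'
  have hsymm : ∀ q ∈ W, ContDiffAt ℝ ∞ T.symm q := by
    intro q hq
    obtain ⟨e, he⟩ := hΦd _ hq.2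
    exact T.contDiffAt_symm hq.1 he (hΦs.contDiffAt (hU.mem_nhds hq.2.1))
  obtain ⟨r, hr, hrW⟩ := Metric.isOpen_iff.1 hWo _ hΦW
  let χ : ContDiffBump (Φ z₀) := ⟨r / 4, r / 2, by positivity, by linarith⟩
  set h : ℝ × ℝ → ℝ := fun q => χ q * g (T.symm q) with hh
  have hχW : tsupport χ ⊆ W := by
    rw [χ.tsupport_eq]
    exact (Metric.closedBall_subset_ball (show r / 2 < r by linarith)).trans hrW
  have hhs : ContDiff ℝ ∞ h := by
    refine contDiff_iff_contDiffAt.2 fun q => ?_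
    by_cases hq : q ∈ W
    · refine χ.contDiff.contDiffAt.mul ?_
      exact ContDiffAt.comp q (hg.contDiffAt (hU.mem_nhds hq.2.1)) (hsymm q hq)
    · have : h =ᶠ[nhds q] fun _ => 0 := by
        have h1 := notMem_tsupport_iff_eventuallyEq.1 fun hc => hq (hχW hc)
        filter_upwards [h1] with w hw
        simp [hh, hw]
      exact contDiffAt_const.congr_of_eventuallyEq this
  have hh0 : ∀ y, h (0, y) = 0 := by
    intro y
    by_cases hq : ((0 : ℝ), y) ∈ W
    · have h1 : Φ (T.symm (0, y)) = (0, y) := T.right_inv hq.1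
      have h2 : d (T.symm (0, y)) = 0 := congrArg Prod.fst h1
      simp [hh, hgd _ hq.2.1 h2]
    · have : χ ((0 : ℝ), y) = 0 := image_eq_zero_of_notMem_tsupport fun hc => hq (hχW hc)
      simp [hh, this]
  obtain ⟨k, hk, hkq⟩ := exists_contDiff_eq_fst_mul hhs hh0
  refine ⟨(T.source ∩ U') ∩ (T.source ∩ T ⁻¹' Metric.ball (Φ z₀) (r / 4)),
    (T.open_source.inter hU').inter (T.isOpen_inter_preimage Metric.isOpen_ball),
    ⟨⟨hzT, hz₀'⟩, hzT, Metric.mem_ball_self (by positivity)⟩, fun z hz => hz.1.2.1,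
    fun z => k (Φ z), hk.comp_contDiffOn (hΦs.mono fun z hz => hz.1.2.1), ?_⟩
  intro z hz
  have h1 := hkq (Φ z)
  have h2 : χ (Φ z) = 1 := χ.one_of_mem_closedBall (Metric.ball_subset_closedBall hz.2.2)
  have h3 : T.symm (Φ z) = z := T.left_inv hz.1.1
  simpa [hh, h2, h3] using h1

/-! ### The Minkowski form -/

section MinkAlgebra

variable {R : Type*} [CommRing R] {n : ℕ}

theorem mink_comm (x y : Fin (n + 1) → R) : mink x y = mink y x := by
  simp only [mink, mul_comm]

theorem mink_add_right (x y z : Fin (n + 1) → R) : mink x (y + z) = mink x y + mink x z := by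
  simp only [mink, Pi.add_apply, mul_add, Finset.sum_add_distrib]
  ring

theorem mink_smul_right (c : R) (x y : Fin (n + 1) → R) : mink x (c • y) = c * mink x y := by
  simp only [mink, Pi.smul_apply, smul_eq_mul, mul_add, Finset.mul_sum]
  congr 1
  · ring
  · exact Finset.sum_congr rfl fun i _ => by ring

theorem mink_add_left (x y z : Fin (n + 1) → R) : mink (x + y) z = mink x z + mink y z := by
  rw [mink_comm, mink_add_right, mink_comm z x, mink_comm z y]

theorem mink_smul_left (c : R) (x y : Fin (n + 1) → R) : mink (c • x) y = c * mink x y := by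
  rw [mink_comm, mink_smul_right, mink_comm]

theorem mink_neg_right (x y : Fin (n + 1) → R) : mink x (-y) = -mink x y := by
  rw [← neg_one_smul R y, mink_smul_right, neg_one_mul]

theorem mink_sub_right (x y z : Fin (n + 1) → R) : mink x (y - z) = mink x y - mink x z := by
  rw [sub_eq_add_neg, mink_add_right, mink_neg_right, sub_eq_add_neg]

theorem mink_sub_left (x y z : Fin (n + 1) → R) : mink (x - y) z = mink x z - mink y z := by
  rw [mink_comm, mink_sub_right, mink_comm z x, mink_comm z y]

theorem mink_zero_right (x : Fin (n + 1) → R) : mink x 0 = 0 := by simp [mink]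

theorem mink_zero_left (x : Fin (n + 1) → R) : mink 0 x = 0 := by simp [mink]

theorem mink_four (x y : Fin 4 → R) :
    mink x y = -(x 0 * y 0) + (x 1 * y 1 + x 2 * y 2 + x 3 * y 3) := by
  simp only [mink, Fin.sum_univ_three]
  rfl

theorem mink_eq_init_add_last (x y : Fin 5 → R) :
    mink x y = mink (fun i : Fin 4 => x i.castSucc) (fun i : Fin 4 => y i.castSucc)
      + x 4 * y 4 := by
  rw [mink_four]
  simp only [mink, Fin.sum_univ_four]
  change -(x 0 * y 0) + (x 1 * y 1 + x 2 * y 2 + x 3 * y 3 + x 4 * y 4) =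
    -(x 0 * y 0) + (x 1 * y 1 + x 2 * y 2 + x 3 * y 3) + x 4 * y 4
  ring

end MinkAlgebra

theorem mink_ofReal {n : ℕ} (x y : Fin (n + 1) → ℝ) :
    mink (fun i => (x i : ℂ)) (fun i => (y i : ℂ)) = ((mink x y : ℝ) : ℂ) := by
  simp [mink]

/-- A light-like vector whose time component vanishes is zero. -/
theorem eq_zero_of_mink_self_eq_zero {n : ℕ} {x : Fin (n + 1) → ℝ} (h : mink x x = 0)
    (h0 : x 0 = 0) : x = 0 := by
  have hs : ∑ i : Fin n, x i.succ * x i.succ = 0 := by simpa [mink, h0] using h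
  rw [Finset.sum_eq_zero_iff_of_nonneg fun i _ => mul_self_nonneg _] at hs
  funext i
  refine Fin.cases h0 (fun j => ?_) i
  exact mul_self_eq_zero.1 (hs j (Finset.mem_univ j))

/-! ### The dual vector of a point of an immersed surface -/

/-- The `3 × 3` minor of the rows `a, b, c` in the columns `i, j, k`. -/
def minorThree (a b c : Fin 4 → ℝ) (i j k : Fin 4) : ℝ :=
  a i * (b j * c k - b k * c j) - a j * (b i * c k - b k * c i) + a k * (b i * c j - b j * c i)

/-- The Minkowski cross product of three vectors, normalized by
`⟨crossVec a b c, w⟩ = -det (a, w, b, c)`. -/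
def crossVec (a b c : Fin 4 → ℝ) : Fin 4 → ℝ :=
  ![-minorThree a b c 1 2 3, -minorThree a b c 0 2 3, minorThree a b c 0 1 3,
    -minorThree a b c 0 1 2]

theorem det_eq_neg_mink_crossVec (a w b c : Fin 4 → ℝ) :
    Matrix.det (Matrix.of ![a, w, b, c]) = -mink (crossVec a b c) w := by
  rw [mink_four, Matrix.det_succ_row_zero]
  simp [Fin.sum_univ_succ, Matrix.det_fin_three, crossVec, minorThree, Fin.succAbove]
  ring

theorem mink_crossVec_first (a b c : Fin 4 → ℝ) : mink (crossVec a b c) a = 0 := by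
  rw [mink_four]; simp [crossVec, minorThree]; ring

theorem mink_crossVec_second (a b c : Fin 4 → ℝ) : mink (crossVec a b c) b = 0 := by
  rw [mink_four]; simp [crossVec, minorThree]; ring

theorem mink_crossVec_third (a b c : Fin 4 → ℝ) : mink (crossVec a b c) c = 0 := by
  rw [mink_four]; simp [crossVec, minorThree]; ring

/-- The Lagrange identity for the Minkowski cross product. -/
theorem mink_crossVec_self (a b c : Fin 4 → ℝ) :
    mink (crossVec a b c) (crossVec a b c) =
      -(mink a a * (mink b b * mink c c - mink b c ^ 2)
        - mink a b * (mink a b * mink c c - mink b c * mink a c)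
        + mink a c * (mink a b * mink b c - mink b b * mink a c)) := by
  simp only [mink_four]; simp [crossVec, minorThree]; ring

theorem crossVec_smul_smul (a e : Fin 4 → ℝ) (s t : ℝ) : crossVec a (s • e) (t • e) = 0 := by
  ext i
  fin_cases i <;> simp [crossVec, minorThree] <;> ring

theorem crossVec_rotate (a b c : Fin 4 → ℝ) (s t : ℝ) :
    crossVec a (s • b + t • c) (-t • b + s • c) = (s ^ 2 + t ^ 2) • crossVec a b c := by
  ext i
  fin_cases i <;> simp [crossVec, minorThree] <;> ring

/-- A point `n` of `dS₃`, the partial derivatives `p, q` at that point of a map into `dS₃`, and a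
square root `a` of minus the coefficient of its Hopf differential. -/
structure HopfFrame (n p q : Fin 4 → ℝ) (a : ℂ) : Prop where
  unit : mink n n = 1
  orth_fst : mink n p = 0
  orth_snd : mink n q = 0
  diff : mink p p - mink q q = -4 * (a.re ^ 2 - a.im ^ 2)
  mixed : mink p q = 4 * a.re * a.im

/-- `⟨∂N, ∂̄N⟩ - |a|²`, for `p = N_x` and `q = N_y`. -/
def dualDenom (p q : Fin 4 → ℝ) (a : ℂ) : ℝ :=
  (mink p p + mink q q) / 4 - (a.re ^ 2 + a.im ^ 2)

/-- `⟨∂N, ∂̄N⟩ + |a|²`, for `p = N_x` and `q = N_y`. -/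
def dualCodenom (p q : Fin 4 → ℝ) (a : ℂ) : ℝ :=
  (mink p p + mink q q) / 4 + (a.re ^ 2 + a.im ^ 2)

/-- The numerator of the tangential part of the dual vector: `-(ā ∂N + a ∂̄N)`. -/
def dualTangential (p q : Fin 4 → ℝ) (a : ℂ) : Fin 4 → ℝ := a.im • q - a.re • p

/-- The numerator of the dual vector. It is only used with a sign `s = ±1`, which selects one of the
two solutions of `⟨f, f⟩ = -1`. -/
def dualNumer (n p q : Fin 4 → ℝ) (a : ℂ) (s : ℝ) : Fin 4 → ℝ :=
  dualTangential p q a + (s / 2) • crossVec n p q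

/-- The light-like vector of `ℝ^{1,4}` that represents the dual vector. -/
def dualLift (n p q : Fin 4 → ℝ) (a : ℂ) (s : ℝ) : Fin 5 → ℝ :=
  Fin.snoc (α := fun _ => ℝ) (dualNumer n p q a s) (dualDenom p q a)

theorem dualLift_castSucc (n p q : Fin 4 → ℝ) (a : ℂ) (s : ℝ) (i : Fin 4) :
    dualLift n p q a s i.castSucc = dualNumer n p q a s i := by
  simp [dualLift]

theorem dualLift_last (n p q : Fin 4 → ℝ) (a : ℂ) (s : ℝ) :
    dualLift n p q a s 4 = dualDenom p q a := by
  change Fin.snoc (α := fun _ => ℝ) (dualNumer n p q a s) (dualDenom p q a) (Fin.last 4) = _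
  exact Fin.snoc_last _ _

theorem mink_crossVec_dualTangential (n p q : Fin 4 → ℝ) (a : ℂ) :
    mink (crossVec n p q) (dualTangential p q a) = 0 := by
  rw [dualTangential, mink_sub_right, mink_smul_right, mink_smul_right, mink_crossVec_second,
    mink_crossVec_third]
  ring

namespace HopfFrame

variable {n p q : Fin 4 → ℝ} {a : ℂ} (H : HopfFrame n p q a)
include H

theorem gram_eq :
    mink p p * mink q q - mink p q ^ 2 = 4 * (dualDenom p q a * dualCodenom p q a) := by
  rw [dualDenom, dualCodenom, H.mixed]
  linear_combination (mink p p - mink q q - 4 * (a.re ^ 2 - a.im ^ 2)) * (-1 / 4) * H.diff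

theorem mink_crossVec_self_eq : mink (crossVec n p q) (crossVec n p q) =
    -(4 * (dualDenom p q a * dualCodenom p q a)) := by
  rw [mink_crossVec_self, H.unit, H.orth_fst, H.orth_snd, ← H.gram_eq]
  ring

theorem mink_dualNumer (s : ℝ) : mink n (dualNumer n p q a s) = 0 := by
  rw [dualNumer, dualTangential, mink_add_right, mink_sub_right, mink_smul_right, mink_smul_right,
    mink_smul_right, H.orth_fst, H.orth_snd, mink_comm n, mink_crossVec_first]
  ring

theorem mink_fst_dualNumer (s : ℝ) :
    mink p (dualNumer n p q a s) = -2 * a.re * dualDenom p q a := by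
  rw [dualNumer, dualTangential, mink_add_right, mink_sub_right, mink_smul_right, mink_smul_right,
    mink_smul_right, mink_comm p (crossVec n p q), mink_crossVec_second, dualDenom, H.mixed]
  linear_combination (-a.re / 2) * H.diff

theorem mink_snd_dualNumer (s : ℝ) :
    mink q (dualNumer n p q a s) = 2 * a.im * dualDenom p q a := by
  rw [dualNumer, dualTangential, mink_add_right, mink_sub_right, mink_smul_right, mink_smul_right,
    mink_smul_right, mink_comm q (crossVec n p q), mink_crossVec_third, dualDenom, mink_comm q p,
    H.mixed]
  linear_combination (-a.im / 2) * H.diff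

theorem mink_dualNumer_self {s : ℝ} (hs : s ^ 2 = 1) :
    mink (dualNumer n p q a s) (dualNumer n p q a s) = -dualDenom p q a ^ 2 := by
  have h1 : mink (dualNumer n p q a s) (dualNumer n p q a s) =
      a.im * mink q (dualNumer n p q a s) - a.re * mink p (dualNumer n p q a s)
        + s ^ 2 / 4 * mink (crossVec n p q) (crossVec n p q) := by
    conv_lhs => rw [dualNumer, mink_add_left, ← dualNumer, dualTangential, mink_sub_left,
      mink_smul_left, mink_smul_left, mink_smul_left]
    have : mink (crossVec n p q) (dualNumer n p q a s) =
        s / 2 * mink (crossVec n p q) (crossVec n p q) := by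
      rw [dualNumer, mink_add_right, mink_crossVec_dualTangential, mink_smul_right, zero_add]
    rw [this]
    ring
  rw [h1, H.mink_fst_dualNumer, H.mink_snd_dualNumer, hs, H.mink_crossVec_self_eq, dualCodenom,
    dualDenom]
  ring

theorem det_dualNumer (s : ℝ) : Matrix.det (Matrix.of ![n, dualNumer n p q a s, p, q]) =
    2 * s * (dualDenom p q a * dualCodenom p q a) := by
  rw [det_eq_neg_mink_crossVec, dualNumer, mink_add_right, mink_crossVec_dualTangential,
    mink_smul_right, H.mink_crossVec_self_eq]
  ring

theorem mem_lightCone_dualLift {s : ℝ} (hs : s ^ 2 = 1) :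
    mink (dualLift n p q a s) (dualLift n p q a s) = 0 := by
  rw [mink_eq_init_add_last]
  simp only [dualLift_castSucc, dualLift_last]
  change mink (dualNumer n p q a s) (dualNumer n p q a s) + _ = 0
  rw [H.mink_dualNumer_self hs]
  ring

/-- Where the rank is at most one and the denominator of the dual vector vanishes, the tangential
part of the numerator vanishes too. -/
theorem re_smul_eq_im_smul {e : Fin 4 → ℝ} {x y : ℝ} (hp : p = x • e) (hq : q = y • e)
    (ha : a ≠ 0) (hm : dualDenom p q a = 0) : a.re • p = a.im • q := by
  have ha2 : 0 < a.re ^ 2 + a.im ^ 2 := by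
    have := Complex.normSq_pos.2 ha
    rw [Complex.normSq_apply] at this
    nlinarith
  have hsum : mink p p + mink q q = 4 * (a.re ^ 2 + a.im ^ 2) := by
    rw [dualDenom] at hm
    linarith
  have hpp : mink p p = x * x * mink e e := by rw [hp, mink_smul_left, mink_smul_right]; ring
  have hqq : mink q q = y * y * mink e e := by rw [hq, mink_smul_left, mink_smul_right]; ring
  have hpq : mink p q = x * y * mink e e := by
    rw [hp, hq, mink_smul_left, mink_smul_right]; ring
  have he : mink e e ≠ 0 := by
    intro h0
    rw [hpp, hqq, h0] at hsum
    simp only [mul_zero, add_zero] at hsum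
    linarith
  have hdiff := H.diff
  have hmix := H.mixed
  have hz : (a.re * x - a.im * y) ^ 2 * mink e e = 0 := by
    rw [hpp, hqq] at hsum hdiff
    rw [hpq] at hmix
    linear_combination (a.re ^ 2 + a.im ^ 2) / 2 * hsum + (a.re ^ 2 - a.im ^ 2) / 2 * hdiff
      - 2 * a.re * a.im * hmix
  have hz' : a.re * x - a.im * y = 0 := by
    simpa using (mul_eq_zero.1 hz).resolve_right he
  rw [hp, hq, smul_smul, smul_smul, sub_eq_zero.1 hz']

end HopfFrame

/-- The lift is covariant under holomorphic changes of coordinates with derivative `c`. -/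
theorem dualLift_change (n p q : Fin 4 → ℝ) (a c : ℂ) (s : ℝ) :
    dualLift n (c.re • p + c.im • q) (-c.im • p + c.re • q) (a * c) s =
      (c.re ^ 2 + c.im ^ 2) • dualLift n p q a s := by
  have hd : dualDenom (c.re • p + c.im • q) (-c.im • p + c.re • q) (a * c) =
      (c.re ^ 2 + c.im ^ 2) * dualDenom p q a := by
    simp only [dualDenom, mink_add_left, mink_add_right, mink_smul_left, mink_smul_right,
      Complex.mul_re, Complex.mul_im, mink_comm q p]
    ring
  funext i
  refine Fin.lastCases ?_ (fun j => ?_) i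
  · change dualLift _ _ _ _ _ 4 = _ * dualLift _ _ _ _ _ 4
    rw [dualLift_last, dualLift_last, hd]
  · rw [Pi.smul_apply, dualLift_castSucc, dualLift_castSucc, dualNumer, dualNumer, crossVec_rotate]
    simp only [dualTangential, Pi.add_apply, Pi.sub_apply, Pi.smul_apply, smul_eq_mul,
      Complex.mul_re, Complex.mul_im]
    ring

theorem dualCodenom_change (p q : Fin 4 → ℝ) (a c : ℂ) :
    dualCodenom (c.re • p + c.im • q) (-c.im • p + c.re • q) (a * c) =
      (c.re ^ 2 + c.im ^ 2) * dualCodenom p q a := by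
  simp only [dualCodenom, mink_add_left, mink_add_right, mink_smul_left, mink_smul_right,
    Complex.mul_re, Complex.mul_im, mink_comm q p]
  ring

/-! ### Calculus of the Minkowski form -/

section MinkCalculus

variable {E : Type*} [NormedAddCommGroup E] [NormedSpace ℝ E] {𝕜 : Type*} [RCLike 𝕜] {m : ℕ}

theorem ContDiffOn.mink {U : Set E} {k : WithTop ℕ∞} {F G : E → Fin (m + 1) → 𝕜}
    (hF : ContDiffOn ℝ k F U) (hG : ContDiffOn ℝ k G U) :
    ContDiffOn ℝ k (fun z => mink (F z) (G z)) U := by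
  rw [contDiffOn_pi] at hF hG
  exact ((hF 0).mul (hG 0)).neg.add (ContDiffOn.sum fun i _ => (hF i.succ).mul (hG i.succ))

theorem fderiv_mink {F G : E → Fin (m + 1) → 𝕜} {z : E} (hF : DifferentiableAt ℝ F z)
    (hG : DifferentiableAt ℝ G z) (v : E) :
    fderiv ℝ (fun z => mink (F z) (G z)) z v =
      mink (fderiv ℝ F z v) (G z) + mink (F z) (fderiv ℝ G z v) := by
  have h1 := fun i => hasFDerivAt_pi'.1 hF.hasFDerivAt i
  have h2 := fun i => hasFDerivAt_pi'.1 hG.hasFDerivAt i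
  have h3 : HasFDerivAt (fun z => mink (F z) (G z)) _ z :=
    ((h1 0).mul (h2 0)).neg.add
      (HasFDerivAt.fun_sum fun i _ => (h1 (Fin.succ i)).mul (h2 (Fin.succ i)))
  rw [h3.fderiv]
  simp [mink, Finset.sum_add_distrib]
  simp only [mul_comm]
  ring

end MinkCalculus

theorem gramDet_eq {m : ℕ} (F : ℂ → Fin (m + 1) → ℝ) (z : ℂ) : gramDet F z =
    mink (fderiv ℝ F z 1) (fderiv ℝ F z 1) *
        mink (fderiv ℝ F z Complex.I) (fderiv ℝ F z Complex.I) -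
      mink (fderiv ℝ F z 1) (fderiv ℝ F z Complex.I) ^ 2 := by
  rw [gramDet, Matrix.det_fin_two_of, mink_comm (fderiv ℝ F z Complex.I) (fderiv ℝ F z 1)]
  ring

theorem hopf_eq {m : ℕ} (F : ℂ → Fin (m + 1) → ℝ) (z : ℂ) : hopf F z =
    (((mink (fderiv ℝ F z 1) (fderiv ℝ F z 1) -
        mink (fderiv ℝ F z Complex.I) (fderiv ℝ F z Complex.I) : ℝ) : ℂ) -
      2 * Complex.I * ((mink (fderiv ℝ F z 1) (fderiv ℝ F z Complex.I) : ℝ) : ℂ)) / 4 := by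
  have h : dz F z = (2⁻¹ : ℂ) • ((fun i => ((fderiv ℝ F z 1 i : ℝ) : ℂ)) -
      Complex.I • fun i => ((fderiv ℝ F z Complex.I i : ℝ) : ℂ)) := by
    funext i
    simp [dz]
    ring
  rw [hopf, h]
  simp only [mink_smul_left, mink_smul_right, mink_sub_left, mink_sub_right, mink_ofReal,
    mink_comm (fderiv ℝ F z Complex.I) (fderiv ℝ F z 1)]
  push_cast
  linear_combination (1 / 4 : ℂ) *
    (mink (fderiv ℝ F z Complex.I) (fderiv ℝ F z Complex.I) : ℝ) * Complex.I_sq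

/-! ### Maps into de Sitter space in a holomorphic coordinate -/

/-- A harmonic map `n` from an open set `U` of the complex plane into `dS₃` with Hopf differential
`-(a dz)²`. -/
structure HarmonicPatch (U : Set ℂ) (n : ℂ → Fin 4 → ℝ) (a : ℂ → ℂ) : Prop where
  isOpen : IsOpen U
  smooth : ContDiffOn ℝ ∞ n U
  smooth_root : ContDiffOn ℝ ∞ a U
  unit : ∀ z ∈ U, mink (n z) (n z) = 1
  hopf_eq : ∀ z ∈ U, hopf n z = -(a z) ^ 2
  harmonic : ∀ z ∈ U, ∃ μ : ℝ, Laplacian.laplacian n z = μ • n z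

/-- The rank of `n` drops transversally along the curve `d = 0`, with fixed sign `ε`, away from the
zeros of the Hopf differential. -/
structure RankDropPatch (U : Set ℂ) (n : ℂ → Fin 4 → ℝ) (a : ℂ → ℂ) (d : ℂ → ℝ) (ε : ℝ) :
    Prop where
  smooth : ContDiffOn ℝ ∞ d U
  sign : ε = 1 ∨ ε = -1
  sq_eq : ∀ z ∈ U, d z ^ 2 = ε * gramDet n z
  regular : ∀ z ∈ U, d z = 0 → fderiv ℝ d z ≠ 0
  root_ne : ∀ z ∈ U, d z = 0 → a z ≠ 0
  rank_le : ∀ z ∈ U, d z = 0 → ∃ (e : Fin 4 → ℝ) (x y : ℝ),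
    fderiv ℝ n z 1 = x • e ∧ fderiv ℝ n z Complex.I = y • e

theorem ContDiffOn.fderiv_apply_const {F : Type*} [NormedAddCommGroup F] [NormedSpace ℝ F]
    {U : Set ℂ} (hU : IsOpen U) {n : ℂ → F} (hn : ContDiffOn ℝ ∞ n U) (v : ℂ) :
    ContDiffOn ℝ ∞ (fun z => fderiv ℝ n z v) U :=
  (hn.fderiv_of_isOpen hU (m := ∞) le_rfl).clm_apply contDiffOn_const

theorem ContDiffOn.complex_re {U : Set ℂ} {a : ℂ → ℂ} (ha : ContDiffOn ℝ ∞ a U) :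
    ContDiffOn ℝ ∞ (fun z => (a z).re) U :=
  Complex.reCLM.contDiff.comp_contDiffOn ha

theorem ContDiffOn.complex_im {U : Set ℂ} {a : ℂ → ℂ} (ha : ContDiffOn ℝ ∞ a U) :
    ContDiffOn ℝ ∞ (fun z => (a z).im) U :=
  Complex.imCLM.contDiff.comp_contDiffOn ha

theorem ContDiffOn.crossVec {U : Set ℂ} {f g h : ℂ → Fin 4 → ℝ} (hf : ContDiffOn ℝ ∞ f U)
    (hg : ContDiffOn ℝ ∞ g U) (hh : ContDiffOn ℝ ∞ h U) :
    ContDiffOn ℝ ∞ (fun z => crossVec (f z) (g z) (h z)) U := by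
  rw [contDiffOn_pi] at hf hg hh
  have hm : ∀ i j k, ContDiffOn ℝ ∞ (fun z => minorThree (f z) (g z) (h z) i j k) U := fun i j k =>
    (((hf i).mul (((hg j).mul (hh k)).sub ((hg k).mul (hh j)))).sub
      ((hf j).mul (((hg i).mul (hh k)).sub ((hg k).mul (hh i))))).add
      ((hf k).mul (((hg i).mul (hh j)).sub ((hg j).mul (hh i))))
  refine contDiffOn_pi.2 fun i => ?_
  fin_cases i
  · exact (hm 1 2 3).neg
  · exact (hm 0 2 3).neg
  · exact hm 0 1 3
  · exact (hm 0 1 2).neg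

theorem contDiffOn_finSnoc {U : Set ℂ} {X : ℂ → Fin 4 → ℝ} {τ : ℂ → ℝ}
    (hX : ContDiffOn ℝ ∞ X U) (hτ : ContDiffOn ℝ ∞ τ U) :
    ContDiffOn ℝ ∞ (fun z => (Fin.snoc (α := fun _ => ℝ) (X z) (τ z) : Fin 5 → ℝ)) U := by
  refine contDiffOn_pi.2 fun i => ?_
  refine Fin.lastCases ?_ (fun j => ?_) i
  · simpa only [Fin.snoc_last] using hτ
  · simpa only [Fin.snoc_castSucc] using contDiffOn_pi.1 hX j

/-- The dual lift of `n` at `z`, with the sign that makes the dual map positively oriented. Where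
`dualCodenom` vanishes the sign is the junk value `0`; such points lie on the curve. -/
def dualLiftAt (n : ℂ → Fin 4 → ℝ) (a : ℂ → ℂ) (z : ℂ) : Fin 5 → ℝ :=
  dualLift (n z) (fderiv ℝ n z 1) (fderiv ℝ n z Complex.I) (a z)
    (Real.sign (dualCodenom (fderiv ℝ n z 1) (fderiv ℝ n z Complex.I) (a z)))

namespace HarmonicPatch

variable {U : Set ℂ} {n : ℂ → Fin 4 → ℝ} {a : ℂ → ℂ} (H : HarmonicPatch U n a)
include H

theorem differentiableAt {z : ℂ} (hz : z ∈ U) : DifferentiableAt ℝ n z :=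
  (H.smooth.contDiffAt (H.isOpen.mem_nhds hz)).differentiableAt (by simp)

theorem mink_fderiv {z : ℂ} (hz : z ∈ U) (v : ℂ) : mink (n z) (fderiv ℝ n z v) = 0 := by
  have h1 : (fun w => mink (n w) (n w)) =ᶠ[nhds z] fun _ => 1 := by
    filter_upwards [H.isOpen.mem_nhds hz] with w hw using H.unit w hw
  have h2 := fderiv_mink (H.differentiableAt hz) (H.differentiableAt hz) v
  rw [h1.fderiv_eq, mink_comm (fderiv ℝ n z v)] at h2
  simp at h2
  linarith

theorem hopfFrame {z : ℂ} (hz : z ∈ U) :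
    HopfFrame (n z) (fderiv ℝ n z 1) (fderiv ℝ n z Complex.I) (a z) := by
  have h := H.hopf_eq z hz
  rw [_root_.hopf_eq] at h
  have h' := congrArg (fun w => 4 * w) h
  rw [mul_div_cancel₀ _ (by norm_num : (4 : ℂ) ≠ 0)] at h'
  have hre := congrArg Complex.re h'
  have him := congrArg Complex.im h'
  simp [sq] at hre him
  refine ⟨H.unit z hz, H.mink_fderiv hz 1, H.mink_fderiv hz Complex.I, ?_, ?_⟩ <;> linarith

theorem contDiffOn_dualDenom : ContDiffOn ℝ ∞
    (fun z => dualDenom (fderiv ℝ n z 1) (fderiv ℝ n z Complex.I) (a z)) U := by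
  have h1 := H.smooth.fderiv_apply_const H.isOpen 1
  have h2 := H.smooth.fderiv_apply_const H.isOpen Complex.I
  exact (((h1.mink h1).add (h2.mink h2)).div_const 4).sub
    ((H.smooth_root.complex_re.pow 2).add (H.smooth_root.complex_im.pow 2))

theorem contDiffOn_dualCodenom : ContDiffOn ℝ ∞
    (fun z => dualCodenom (fderiv ℝ n z 1) (fderiv ℝ n z Complex.I) (a z)) U := by
  have h1 := H.smooth.fderiv_apply_const H.isOpen 1
  have h2 := H.smooth.fderiv_apply_const H.isOpen Complex.I
  exact (((h1.mink h1).add (h2.mink h2)).div_const 4).add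
    ((H.smooth_root.complex_re.pow 2).add (H.smooth_root.complex_im.pow 2))

theorem contDiffOn_dualTangential : ContDiffOn ℝ ∞
    (fun z => dualTangential (fderiv ℝ n z 1) (fderiv ℝ n z Complex.I) (a z)) U :=
  (H.smooth_root.complex_im.smul (H.smooth.fderiv_apply_const H.isOpen Complex.I)).sub
    (H.smooth_root.complex_re.smul (H.smooth.fderiv_apply_const H.isOpen 1))

theorem contDiffOn_crossVec : ContDiffOn ℝ ∞
    (fun z => crossVec (n z) (fderiv ℝ n z 1) (fderiv ℝ n z Complex.I)) U :=
  H.smooth.crossVec (H.smooth.fderiv_apply_const H.isOpen 1)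
    (H.smooth.fderiv_apply_const H.isOpen Complex.I)

theorem contDiffOn_dualLift (s : ℝ) : ContDiffOn ℝ ∞
    (fun z => dualLift (n z) (fderiv ℝ n z 1) (fderiv ℝ n z Complex.I) (a z) s) U :=
  contDiffOn_finSnoc (H.contDiffOn_dualTangential.add (H.contDiffOn_crossVec.const_smul (s / 2)))
    H.contDiffOn_dualDenom

theorem gramDet_eq {z : ℂ} (hz : z ∈ U) : gramDet n z =
    4 * (dualDenom (fderiv ℝ n z 1) (fderiv ℝ n z Complex.I) (a z) *
      dualCodenom (fderiv ℝ n z 1) (fderiv ℝ n z Complex.I) (a z)) := by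
  rw [_root_.gramDet_eq, (H.hopfFrame hz).gram_eq]

end HarmonicPatch

namespace RankDropPatch

variable {U : Set ℂ} {n : ℂ → Fin 4 → ℝ} {a : ℂ → ℂ} {d : ℂ → ℝ} {ε : ℝ}

/-- Continuous functions that agree off the curve `d = 0` agree everywhere, since a regular curve
has dense complement. -/
theorem eqOn_of_eqOn_ne_zero (D : RankDropPatch U n a d ε) {Y : Type*} [TopologicalSpace Y]
    [T2Space Y] {V : Set ℂ} (hV : IsOpen V)
    (hVU : V ⊆ U) {p q : ℂ → Y} (hp : ContinuousOn p V) (hq : ContinuousOn q V)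
    (h : ∀ z ∈ V, d z ≠ 0 → p z = q z) : ∀ z ∈ V, p z = q z := by
  intro z hz
  by_contra hne
  have hev : ∀ᶠ w in nhds z, p w ≠ q w :=
    ((hp.continuousAt (hV.mem_nhds hz)).ne_iff_eventually_ne
      (hq.continuousAt (hV.mem_nhds hz))).1 hne
  have hd : d =ᶠ[nhds z] fun _ => 0 := by
    filter_upwards [hev, hV.mem_nhds hz] with w hw hwV
    by_contra hdw
    exact hw (h w hwV hdw)
  refine D.regular z (hVU hz) hd.self_of_nhds ?_
  rw [hd.fderiv_eq]
  simp

end RankDropPatch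

/-! ### Smooth light-like lifts of the dual map -/

theorem exists_contDiffOn_eq_smul {m : ℕ} {U : Set ℂ} (hU : IsOpen U) {d : ℂ → ℝ}
    {g : ℂ → Fin m → ℝ} (hd : ContDiffOn ℝ ∞ d U) (hg : ContDiffOn ℝ ∞ g U) {z₀ : ℂ} (hz₀ : z₀ ∈ U)
    (hd' : fderiv ℝ d z₀ ≠ 0) (hgd : ∀ z ∈ U, d z = 0 → g z = 0) :
    ∃ V : Set ℂ, IsOpen V ∧ z₀ ∈ V ∧ V ⊆ U ∧ ∃ k : ℂ → Fin m → ℝ, ContDiffOn ℝ ∞ k V ∧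
      ∀ z ∈ V, g z = d z • k z := by
  have h := fun i => exists_contDiffOn_eq_mul hU hd (contDiffOn_pi.1 hg i) hz₀ hd'
    fun z hz hdz => by rw [hgd z hz hdz, Pi.zero_apply]
  choose V hVo hzV hVU k hk hgk using h
  refine ⟨U ∩ ⋂ i, V i, hU.inter (isOpen_iInter_of_finite hVo), ⟨hz₀, Set.mem_iInter.2 hzV⟩,
    Set.inter_subset_left, fun z i => k i z, contDiffOn_pi.2 fun i => (hk i).mono fun z hz =>
      Set.mem_iInter.1 hz.2 i, fun z hz => funext fun i => hgk i z (Set.mem_iInter.1 hz.2 i)⟩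

/-- The first four components of a vector of `ℝ^{1,4}`. -/
def initFour (x : Fin 5 → ℝ) : Fin 4 → ℝ := fun i => x i.castSucc

theorem initFour_dualLift (n p q : Fin 4 → ℝ) (a : ℂ) (s : ℝ) :
    initFour (dualLift n p q a s) = dualNumer n p q a s :=
  funext fun i => dualLift_castSucc n p q a s i

theorem contDiffOn_initFour {U : Set ℂ} {L : ℂ → Fin 5 → ℝ} (hL : ContDiffOn ℝ ∞ L U) :
    ContDiffOn ℝ ∞ (fun z => initFour (L z)) U :=
  contDiffOn_pi.2 fun i => contDiffOn_pi.1 hL i.castSucc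

/-- `L` is a smooth light-like lift of the dual map over the open set `V`; it extends the dual map
across the curve `d = 0`, and meets the hyperplane `x₄ = 0` transversally and only there. -/
structure IsDualLiftOn (V : Set ℂ) (n : ℂ → Fin 4 → ℝ) (a : ℂ → ℂ) (d : ℂ → ℝ)
    (L : ℂ → Fin 5 → ℝ) : Prop where
  smooth : ContDiffOn ℝ ∞ L V
  time_ne : ∀ z ∈ V, L z 0 ≠ 0
  light : ∀ z ∈ V, mink (L z) (L z) = 0
  orth : ∀ z ∈ V, mink (n z) (initFour (L z)) = 0
  pair_fst : ∀ z ∈ V, mink (fderiv ℝ n z 1) (initFour (L z)) = -2 * (a z).re * L z 4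
  pair_snd : ∀ z ∈ V, mink (fderiv ℝ n z Complex.I) (initFour (L z)) = 2 * (a z).im * L z 4
  eq_smul : ∀ z ∈ V, d z ≠ 0 → ∃ r : ℝ, r ≠ 0 ∧ L z = r • dualLiftAt n a z
  transversal : ∀ z ∈ V, L z 4 = 0 → d z = 0 ∧
    dualDenom (fderiv ℝ n z 1) (fderiv ℝ n z Complex.I) (a z) = 0 ∧
    fderiv ℝ (fun w => L w 4) z ≠ 0

theorem Real.sign_eq_of_mul_pos {s x : ℝ} (hs : s = 1 ∨ s = -1) (h : 0 < s * x) :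
    Real.sign x = s := by
  rcases hs with rfl | rfl
  · exact Real.sign_of_pos (by linarith)
  · exact Real.sign_of_neg (by linarith)

section

variable {U : Set ℂ} {n : ℂ → Fin 4 → ℝ} {a : ℂ → ℂ} {d : ℂ → ℝ} {ε : ℝ}

theorem RankDropPatch.dualDenom_mul_dualCodenom_pos (D : RankDropPatch U n a d ε)
    (H : HarmonicPatch U n a) {z : ℂ} (hz : z ∈ U) (hdz : d z ≠ 0) :
    0 < ε * (dualDenom (fderiv ℝ n z 1) (fderiv ℝ n z Complex.I) (a z) *
      dualCodenom (fderiv ℝ n z 1) (fderiv ℝ n z Complex.I) (a z)) := by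
  have h := D.sq_eq z hz
  rw [H.gramDet_eq hz] at h
  have : 0 < d z ^ 2 := by positivity
  linarith

/-- At a point where the dual map has a finite value, the dual lift itself is smooth: the sign in
it is locally constant because the Gram determinant has a constant sign. -/
theorem exists_isDualLiftOn_of_dualDenom_ne_zero (H : HarmonicPatch U n a)
    (D : RankDropPatch U n a d ε) {z₀ : ℂ} (hz₀ : z₀ ∈ U)
    (h0 : dualDenom (fderiv ℝ n z₀ 1) (fderiv ℝ n z₀ Complex.I) (a z₀) ≠ 0) :
    ∃ V : Set ℂ, IsOpen V ∧ z₀ ∈ V ∧ V ⊆ U ∧ ∃ L, IsDualLiftOn V n a d L := by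
  set δ : ℂ → ℝ := fun z => dualDenom (fderiv ℝ n z 1) (fderiv ℝ n z Complex.I) (a z) with hδ
  have hδ0 : δ z₀ ≠ 0 := h0
  set σ : ℝ := Real.sign (δ z₀) with hσ
  set V : Set ℂ := U ∩ {z | 0 < σ * δ z} with hV
  have hVo : IsOpen V :=
    (continuousOn_const.mul H.contDiffOn_dualDenom.continuousOn).isOpen_inter_preimage H.isOpen
      isOpen_Ioi
  have hσ' : σ = 1 ∨ σ = -1 := (Real.sign_apply_eq_of_ne_zero _ hδ0).symm
  have hεσ : ε * σ = 1 ∨ ε * σ = -1 := by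
    rcases D.sign with h | h <;> rcases hσ' with h' | h' <;> rw [h, h'] <;> norm_num
  have hsq : (ε * σ) ^ 2 = 1 := by rcases hεσ with h | h <;> rw [h] <;> norm_num
  have hne : ∀ z ∈ V, δ z ≠ 0 := fun z hz h => by
    have : 0 < σ * δ z := hz.2
    rw [h, mul_zero] at this
    exact lt_irrefl _ this
  refine ⟨V, hVo, ⟨hz₀, Real.sign_mul_pos_of_ne_zero _ hδ0⟩, Set.inter_subset_left, fun z =>
    dualLift (n z) (fderiv ℝ n z 1) (fderiv ℝ n z Complex.I) (a z) (ε * σ), ?_⟩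
  have hlight : ∀ z ∈ V, _ := fun z hz => (H.hopfFrame hz.1).mem_lightCone_dualLift hsq
  refine ⟨(H.contDiffOn_dualLift _).mono Set.inter_subset_left, fun z hz ht => ?_, hlight,
    fun z hz => ?_, fun z hz => ?_, fun z hz => ?_, fun z hz hdz => ⟨1, one_ne_zero, ?_⟩,
    fun z hz h4 => ?_⟩
  · have h1 := congrFun (eq_zero_of_mink_self_eq_zero (hlight z hz) ht) 4
    rw [dualLift_last] at h1
    exact hne z hz h1
  · rw [initFour_dualLift, (H.hopfFrame hz.1).mink_dualNumer]
  · rw [initFour_dualLift, (H.hopfFrame hz.1).mink_fst_dualNumer, dualLift_last]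
  · rw [initFour_dualLift, (H.hopfFrame hz.1).mink_snd_dualNumer, dualLift_last]
  · rw [one_smul, dualLiftAt, Real.sign_eq_of_mul_pos hεσ]
    have h1 := D.dualDenom_mul_dualCodenom_pos H hz.1 hdz
    have h2 : 0 < σ * δ z := hz.2
    have h3 : σ ^ 2 = 1 := by rcases hσ' with h | h <;> rw [h] <;> norm_num
    have h4 : 0 < δ z ^ 2 := by have := hne z hz; positivity
    refine (mul_pos_iff_of_pos_right h4).1 ?_
    have h5 := mul_pos h2 h1
    simp only [hδ] at h5 ⊢
    linarith
  · rw [dualLift_last] at h4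
    exact absurd h4 (hne z hz)

/-- At a point where the dual map tends to infinity, the dual lift vanishes along the curve
`d = 0`, and its quotient by `d` is smooth and does not vanish. -/
theorem exists_isDualLiftOn_of_dualDenom_eq_zero (H : HarmonicPatch U n a)
    (D : RankDropPatch U n a d ε) {z₀ : ℂ} (hz₀ : z₀ ∈ U)
    (h0 : dualDenom (fderiv ℝ n z₀ 1) (fderiv ℝ n z₀ Complex.I) (a z₀) = 0) :
    ∃ V : Set ℂ, IsOpen V ∧ z₀ ∈ V ∧ V ⊆ U ∧ ∃ L, IsDualLiftOn V n a d L := by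
  set δ : ℂ → ℝ := fun z => dualDenom (fderiv ℝ n z 1) (fderiv ℝ n z Complex.I) (a z) with hδ
  set κ : ℂ → ℝ := fun z => dualCodenom (fderiv ℝ n z 1) (fderiv ℝ n z Complex.I) (a z) with hκ
  set T : ℂ → Fin 4 → ℝ :=
    fun z => dualTangential (fderiv ℝ n z 1) (fderiv ℝ n z Complex.I) (a z) with hT
  set C : ℂ → Fin 4 → ℝ :=
    fun z => crossVec (n z) (fderiv ℝ n z 1) (fderiv ℝ n z Complex.I) with hC
  have hgram : ∀ z ∈ U, d z ^ 2 = ε * (4 * (δ z * κ z)) := fun z hz => by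
    rw [D.sq_eq z hz, H.gramDet_eq hz]
  have hε2 : ε * ε = 1 := by rcases D.sign with h | h <;> rw [h] <;> norm_num
  have hε0 : ε ≠ 0 := fun h => by simp [h] at hε2
  have hd0 : d z₀ = 0 := by
    have := hgram z₀ hz₀
    have h0' : δ z₀ = 0 := h0
    rw [h0'] at this
    simpa using this
  set W : Set ℂ := U ∩ {z | 0 < κ z} with hW
  have hWo : IsOpen W :=
    H.contDiffOn_dualCodenom.continuousOn.isOpen_inter_preimage H.isOpen isOpen_Ioi
  have hWU : W ⊆ U := Set.inter_subset_left
  have hz₀W : z₀ ∈ W := by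
    refine ⟨hz₀, ?_⟩
    have h1 : κ z₀ = δ z₀ + 2 * ((a z₀).re ^ 2 + (a z₀).im ^ 2) := by
      simp only [hκ, hδ, dualCodenom, dualDenom]; ring
    have h2 := Complex.normSq_pos.2 (D.root_ne z₀ hz₀ hd0)
    rw [Complex.normSq_apply] at h2
    have h0' : δ z₀ = 0 := h0
    change 0 < κ z₀
    rw [h1, h0']
    nlinarith
  have hδ0 : ∀ z ∈ W, d z = 0 → δ z = 0 := fun z hz hdz => by
    have h1 := hgram z hz.1
    have h2 : 0 < κ z := hz.2
    rw [hdz] at h1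
    have h3 : ε * 4 * κ z * δ z = 0 := by linear_combination -h1
    exact (mul_eq_zero.1 h3).resolve_left (mul_ne_zero (mul_ne_zero hε0 four_ne_zero) h2.ne')
  have hT0 : ∀ z ∈ W, d z = 0 → T z = 0 := fun z hz hdz => by
    obtain ⟨e, x, y, hp, hq⟩ := D.rank_le z hz.1 hdz
    have h1 := (H.hopfFrame hz.1).re_smul_eq_im_smul hp hq (D.root_ne z hz.1 hdz) (hδ0 z hz hdz)
    simp only [hT, dualTangential, h1, sub_self]
  have hC0 : ∀ z ∈ W, d z = 0 → C z = 0 := fun z hz hdz => by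
    obtain ⟨e, x, y, hp, hq⟩ := D.rank_le z hz.1 hdz
    simp only [hC, hp, hq, crossVec_smul_smul]
  have hdW := D.smooth.mono hWU
  have hreg := D.regular z₀ hz₀ hd0
  obtain ⟨V₁, hV₁o, hzV₁, hV₁W, kT, hkT, hTk⟩ := exists_contDiffOn_eq_smul hWo hdW
    (H.contDiffOn_dualTangential.mono hWU) hz₀W hreg hT0
  obtain ⟨V₂, hV₂o, hzV₂, hV₂W, kC, hkC, hCk⟩ := exists_contDiffOn_eq_smul hWo hdW
    (H.contDiffOn_crossVec.mono hWU) hz₀W hreg hC0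
  set V := V₁ ∩ V₂ with hV
  have hVo : IsOpen V := hV₁o.inter hV₂o
  have hVW : V ⊆ W := fun z hz => hV₁W hz.1
  have hVU : V ⊆ U := hVW.trans hWU
  have hkT' := hkT.mono (Set.inter_subset_left : V ⊆ V₁)
  have hkC' := hkC.mono (Set.inter_subset_right : V ⊆ V₂)
  have hκpos : ∀ z ∈ V, 0 < κ z := fun z hz => (hVW hz).2
  -- since `d² = 4 ε δ κ`, the quotient `δ / d` is `d` times this unit
  set c : ℂ → ℝ := fun z => ε / (4 * κ z) with hc
  have hcs : ContDiffOn ℝ ∞ c V := contDiffOn_const.div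
    (contDiffOn_const.mul (H.contDiffOn_dualCodenom.mono hVU))
    fun z hz => (mul_pos four_pos (hκpos z hz)).ne'
  have hc0 : ∀ z ∈ V, c z ≠ 0 := fun z hz =>
    div_ne_zero hε0 (mul_pos four_pos (hκpos z hz)).ne'
  have hδd : ∀ z ∈ V, δ z = d z * (d z * c z) := fun z hz => by
    have h1 := hgram z (hVU hz)
    have h2 := (hκpos z hz).ne'
    simp only [hc]
    field_simp
    linear_combination (-ε) * h1 - 4 * κ z * δ z * hε2
  set X : ℂ → Fin 4 → ℝ := fun z => kT z + (1 / 2 : ℝ) • kC z with hX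
  set τ : ℂ → ℝ := fun z => d z * c z with hτ
  set L : ℂ → Fin 5 → ℝ := fun z => Fin.snoc (α := fun _ => ℝ) (X z) (τ z) with hL
  have hL4 : ∀ z, L z 4 = τ z := fun z => Fin.snoc_last (α := fun _ => ℝ) (τ z) (X z)
  have hLX : ∀ z, initFour (L z) = X z := fun z => funext fun i => by simp [hL, initFour]
  have hXs : ContDiffOn ℝ ∞ X V := hkT'.add (hkC'.const_smul _)
  have hτs : ContDiffOn ℝ ∞ τ V := (D.smooth.mono hVU).mul hcs
  have hLs : ContDiffOn ℝ ∞ L V := contDiffOn_finSnoc hXs hτs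
  have hXd : ∀ z ∈ V, d z • X z =
      dualNumer (n z) (fderiv ℝ n z 1) (fderiv ℝ n z Complex.I) (a z) 1 := fun z hz => by
    have h1 := hTk z hz.1
    have h2 := hCk z hz.2
    rw [dualNumer, h1, h2, hX]
    simp only [smul_add, smul_smul, mul_comm]
  have hLd : ∀ z ∈ V, d z • L z =
      dualLift (n z) (fderiv ℝ n z 1) (fderiv ℝ n z Complex.I) (a z) 1 := fun z hz => by
    funext i
    refine Fin.lastCases ?_ (fun j => ?_) i
    · change d z * L z 4 = dualLift _ _ _ _ _ 4
      rw [dualLift_last, hL4]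
      exact (hδd z hz).symm
    · rw [dualLift_castSucc, ← hXd z hz]
      simp [hL]
  have hns := (H.smooth.mono hVU)
  have hn1 := ((H.smooth.fderiv_apply_const H.isOpen 1).mono hVU)
  have hn2 := ((H.smooth.fderiv_apply_const H.isOpen Complex.I).mono hVU)
  have has := H.smooth_root.mono hVU
  have hlight : ∀ z ∈ V, mink (L z) (L z) = 0 :=
    D.eqOn_of_eqOn_ne_zero hVo hVU (hLs.mink hLs).continuousOn continuousOn_const fun z hz hdz => by
      have h1 := (H.hopfFrame (hVU hz)).mem_lightCone_dualLift (s := 1) (by norm_num)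
      rw [← hLd z hz, mink_smul_left, mink_smul_right] at h1
      simpa [hdz] using h1
  have horth : ∀ z ∈ V, mink (n z) (X z) = 0 :=
    D.eqOn_of_eqOn_ne_zero hVo hVU (hns.mink hXs).continuousOn continuousOn_const
      fun z hz hdz => by
        have h1 := (H.hopfFrame (hVU hz)).mink_dualNumer 1
        rw [← hXd z hz, mink_smul_right] at h1
        simpa [hdz] using h1
  have hpair₁ : ∀ z ∈ V, mink (fderiv ℝ n z 1) (X z) = -2 * (a z).re * τ z :=
    D.eqOn_of_eqOn_ne_zero hVo hVU (hn1.mink hXs).continuousOn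
      ((contDiffOn_const.mul has.complex_re).mul hτs).continuousOn fun z hz hdz => by
        have h1 := (H.hopfFrame (hVU hz)).mink_fst_dualNumer 1
        have h2 := hδd z hz
        simp only [hδ] at h2
        rw [← hXd z hz, mink_smul_right, h2] at h1
        refine mul_left_cancel₀ hdz ?_
        rw [h1, hτ]
        ring
  have hpair₂ : ∀ z ∈ V, mink (fderiv ℝ n z Complex.I) (X z) = 2 * (a z).im * τ z :=
    D.eqOn_of_eqOn_ne_zero hVo hVU (hn2.mink hXs).continuousOn
      ((contDiffOn_const.mul has.complex_im).mul hτs).continuousOn fun z hz hdz => by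
        have h1 := (H.hopfFrame (hVU hz)).mink_snd_dualNumer 1
        have h2 := hδd z hz
        simp only [hδ] at h2
        rw [← hXd z hz, mink_smul_right, h2] at h1
        refine mul_left_cancel₀ hdz ?_
        rw [h1, hτ]
        ring
  -- the normal part of the quotient stays nonzero along the curve
  have hnormal : ∀ z ∈ V, mink (kC z) (X z) = -ε / 2 :=
    D.eqOn_of_eqOn_ne_zero hVo hVU (hkC'.mink hXs).continuousOn continuousOn_const
      fun z hz hdz => by
        have h1 : mink (C z) (d z • X z) = -(2 * (δ z * κ z)) := by
          rw [hXd z hz]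
          simp only [hC, dualNumer]
          rw [mink_add_right, mink_crossVec_dualTangential, mink_smul_right,
            (H.hopfFrame (hVU hz)).mink_crossVec_self_eq]
          simp only [hδ, hκ]
          ring
        rw [show C z = d z • kC z from hCk z hz.2, mink_smul_left, mink_smul_right] at h1
        have h2 := hgram z (hVU hz)
        refine mul_left_cancel₀ (mul_ne_zero hdz hdz) ?_
        linear_combination h1 + ε / 2 * h2 + 2 * δ z * κ z * hε2
  refine ⟨V, hVo, ⟨hzV₁, hzV₂⟩, hVU, L, hLs, fun z hz ht => ?_, hlight, fun z hz => ?_,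
    fun z hz => ?_, fun z hz => ?_, fun z hz hdz => ⟨(d z)⁻¹, inv_ne_zero hdz, ?_⟩,
    fun z hz h4 => ?_⟩
  · have h1 := eq_zero_of_mink_self_eq_zero (hlight z hz) ht
    have h2 := hnormal z hz
    rw [← hLX, h1] at h2
    change mink (kC z) 0 = _ at h2
    rw [mink_zero_right] at h2
    exact hε0 (by linarith)
  · rw [hLX, horth z hz]
  · rw [hLX, hL4, hpair₁ z hz]
  · rw [hLX, hL4, hpair₂ z hz]
  · have h1 : Real.sign (dualCodenom (fderiv ℝ n z 1) (fderiv ℝ n z Complex.I) (a z)) = 1 :=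
      Real.sign_of_pos (hκpos z hz)
    rw [dualLiftAt, h1, ← hLd z hz, smul_smul, inv_mul_cancel₀ hdz, one_smul]
  · rw [hL4] at h4
    have hdz : d z = 0 := (mul_eq_zero.1 h4).resolve_right (hc0 z hz)
    refine ⟨hdz, hδ0 z (hVW hz) hdz, ?_⟩
    have hfun : (fun w => L w 4) = fun w => d w * c w := funext fun w => hL4 w
    have hd1 : DifferentiableAt ℝ d z :=
      (D.smooth.contDiffAt (H.isOpen.mem_nhds (hVU hz))).differentiableAt (by simp)
    have hc1 : DifferentiableAt ℝ c z :=
      (hcs.contDiffAt (hVo.mem_nhds hz)).differentiableAt (by simp)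
    rw [hfun, fderiv_fun_mul hd1 hc1, hdz, zero_smul, zero_add]
    exact smul_ne_zero (hc0 z hz) (D.regular z (hVU hz) hdz)

theorem exists_isDualLiftOn (H : HarmonicPatch U n a) (D : RankDropPatch U n a d ε) {z₀ : ℂ}
    (hz₀ : z₀ ∈ U) : ∃ V : Set ℂ, IsOpen V ∧ z₀ ∈ V ∧ V ⊆ U ∧ ∃ L, IsDualLiftOn V n a d L := by
  by_cases h0 : dualDenom (fderiv ℝ n z₀ 1) (fderiv ℝ n z₀ Complex.I) (a z₀) = 0
  · exact exists_isDualLiftOn_of_dualDenom_eq_zero H D hz₀ h0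
  · exact exists_isDualLiftOn_of_dualDenom_ne_zero H D hz₀ h0

end

/-! ### Orthogonal complements in Minkowski space -/

/-- The spatial part of a vector of `ℝ^{1,3}`. -/
def spatial (x : Fin 4 → ℝ) : EuclideanSpace ℝ (Fin 3) := WithLp.toLp 2 fun i => x i.succ

theorem inner_spatial {x y : Fin 4 → ℝ} (h : x 0 = 0 ∨ y 0 = 0) :
    inner ℝ (spatial x) (spatial y) = mink x y := by
  have h0 : x 0 * y 0 = 0 := by rcases h with h | h <;> simp [h]
  simp [spatial, mink, h0, PiLp.inner_apply, mul_comm]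

theorem spatial_eq_zero {x : Fin 4 → ℝ} (h0 : x 0 = 0) (h : spatial x = 0) : x = 0 := by
  funext i
  refine Fin.cases h0 (fun j => ?_) i
  have := congrFun (congrArg WithLp.ofLp h) j
  simpa [spatial] using this

/-- In `ℝ^{1,3}`, the orthogonal complement of two orthonormal space-like vectors and a light-like
vector `X` orthogonal to them is the line of `X`. -/
theorem eq_smul_of_orthogonal_lightlike {n e X w : Fin 4 → ℝ} (hnn : mink n n = 1)
    (hee : mink e e = 1) (hne : mink n e = 0) (hXX : mink X X = 0) (hX0 : X 0 ≠ 0)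
    (hnX : mink n X = 0) (heX : mink e X = 0) (hnw : mink n w = 0) (hew : mink e w = 0)
    (hXw : mink X w = 0) : w = (w 0 / X 0) • X := by
  -- modulo `X` all vectors can be made spatial; four orthogonal vectors in space are dependent
  set r : (Fin 4 → ℝ) → Fin 4 → ℝ := fun y => y - (y 0 / X 0) • X with hr
  have hr0 : ∀ y, r y 0 = 0 := fun y => by simp [hr, hX0]
  have hrr : ∀ y y', mink X y = 0 → mink X y' = 0 → mink (r y) (r y') = mink y y' := by
    intro y y' hy hy'
    simp only [hr, mink_sub_left, mink_sub_right, mink_smul_left, mink_smul_right, hXX, hy',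
      mink_comm y X, hy]
    ring
  have hrX : ∀ y, mink X y = 0 → mink (r y) X = 0 := by
    intro y hy
    simp only [hr, mink_sub_left, mink_smul_left, hXX, mink_comm y X, hy]
    ring
  have hXn : mink X n = 0 := by rw [mink_comm, hnX]
  have hXe : mink X e = 0 := by rw [mink_comm, heX]
  suffices hw : r w = 0 from sub_eq_zero.1 hw
  by_contra hw
  let v : Fin 4 → EuclideanSpace ℝ (Fin 3) :=
    ![spatial (r n), spatial (r e), spatial X, spatial (r w)]
  have hv0 : ∀ i, v i ≠ 0 := by
    intro i hi
    fin_cases i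
    · have h1 := spatial_eq_zero (hr0 n) hi
      have h2 := hrr n n hXn hXn
      rw [h1, hnn, mink_zero_left] at h2
      exact zero_ne_one h2
    · have h1 := spatial_eq_zero (hr0 e) hi
      have h2 := hrr e e hXe hXe
      rw [h1, hee, mink_zero_left] at h2
      exact zero_ne_one h2
    · have h1 : spatial X = 0 := hi
      have h2 : ∀ j : Fin 3, X j.succ = 0 := fun j => by
        simpa [spatial] using congrFun (congrArg WithLp.ofLp h1) j
      have h3 : X 0 * X 0 = 0 := by simpa [mink, h2] using hXX
      exact hX0 (mul_self_eq_zero.1 h3)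
    · exact hw (spatial_eq_zero (hr0 w) hi)
  have o1 : inner ℝ (spatial (r n)) (spatial (r e)) = 0 := by
    rw [inner_spatial (Or.inl (hr0 n)), hrr n e hXn hXe, hne]
  have o2 : inner ℝ (spatial (r n)) (spatial X) = 0 := by
    rw [inner_spatial (Or.inl (hr0 n)), hrX n hXn]
  have o3 : inner ℝ (spatial (r n)) (spatial (r w)) = 0 := by
    rw [inner_spatial (Or.inl (hr0 n)), hrr n w hXn hXw, hnw]
  have o4 : inner ℝ (spatial (r e)) (spatial X) = 0 := by
    rw [inner_spatial (Or.inl (hr0 e)), hrX e hXe]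
  have o5 : inner ℝ (spatial (r e)) (spatial (r w)) = 0 := by
    rw [inner_spatial (Or.inl (hr0 e)), hrr e w hXe hXw, hew]
  have o6 : inner ℝ (spatial (r w)) (spatial X) = 0 := by
    rw [inner_spatial (Or.inl (hr0 w)), hrX w hXw]
  have hvo : Pairwise fun i j => inner ℝ (v i) (v j) = 0 := by
    intro i j hij
    have key : ∀ i j : Fin 4, i < j → inner ℝ (v i) (v j) = 0 := by
      intro i j hij
      fin_cases i <;> fin_cases j <;> first
        | exact absurd hij (by decide)
        | exact o1
        | exact o2
        | exact o3
        | exact o4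
        | exact o5
        | exact (real_inner_comm _ _).trans o6
    rcases lt_or_gt_of_ne hij with h | h
    · exact key i j h
    · rw [real_inner_comm]
      exact key j i h
  have hli := linearIndependent_of_ne_zero_of_inner_eq_zero hv0 hvo
  have := hli.fintype_card_le_finrank
  simp at this

/-! ### Derivatives of vector-valued functions in the plane -/

theorem fderiv_initFour {L : ℂ → Fin 5 → ℝ} {z : ℂ} (hL : DifferentiableAt ℝ L z) (v : ℂ) :
    fderiv ℝ (fun w => initFour (L w)) z v = initFour (fderiv ℝ L z v) := by
  have h := hasFDerivAt_pi'.1 hL.hasFDerivAt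
  have h2 : HasFDerivAt (fun w => initFour (L w)) (ContinuousLinearMap.pi fun i : Fin 4 =>
      (ContinuousLinearMap.proj i.castSucc).comp (fderiv ℝ L z)) z :=
    hasFDerivAt_pi.2 fun i => h i.castSucc
  rw [h2.fderiv]
  rfl

theorem fderiv_component {ι : Type*} [Fintype ι] {F : ℂ → ι → ℝ} {z : ℂ}
    (hF : DifferentiableAt ℝ F z) (i : ι) (v : ℂ) :
    fderiv ℝ (fun w => F w i) z v = fderiv ℝ F z v i := by
  rw [(hasFDerivAt_pi'.1 hF.hasFDerivAt i).fderiv]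
  rfl

theorem fderiv_fderiv_apply {F : Type*} [NormedAddCommGroup F] [NormedSpace ℝ F] {U : Set ℂ}
    (hU : IsOpen U) {n : ℂ → F} (hn : ContDiffOn ℝ ∞ n U) {z : ℂ} (hz : z ∈ U) (v w : ℂ) :
    fderiv ℝ (fun y => fderiv ℝ n y v) z w = fderiv ℝ (fderiv ℝ n) z w v := by
  have h1 : DifferentiableAt ℝ (fderiv ℝ n) z :=
    ((hn.fderiv_of_isOpen hU (m := ∞) le_rfl).contDiffAt (hU.mem_nhds hz)).differentiableAt
      (by simp)
  rw [fderiv_clm_apply h1 (differentiableAt_const v)]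
  simp

theorem fderiv_fderiv_apply_comm {F : Type*} [NormedAddCommGroup F] [NormedSpace ℝ F] {U : Set ℂ}
    (hU : IsOpen U) {n : ℂ → F} (hn : ContDiffOn ℝ ∞ n U) {z : ℂ} (hz : z ∈ U) (v w : ℂ) :
    fderiv ℝ (fun y => fderiv ℝ n y v) z w = fderiv ℝ (fun y => fderiv ℝ n y w) z v := by
  rw [fderiv_fderiv_apply hU hn hz, fderiv_fderiv_apply hU hn hz]
  have h := (hn.contDiffAt (hU.mem_nhds hz)).isSymmSndFDerivAt
    (by
      rw [minSmoothness_of_isRCLikeNormedField]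
      exact WithTop.coe_le_coe.2 (le_top : (2 : ℕ∞) ≤ ⊤))
  exact h w v

theorem laplacian_eq_fderiv_fderiv {F : Type*} [NormedAddCommGroup F] [NormedSpace ℝ F] {U : Set ℂ}
    (hU : IsOpen U) {n : ℂ → F} (hn : ContDiffOn ℝ ∞ n U) {z : ℂ} (hz : z ∈ U) :
    Laplacian.laplacian n z = fderiv ℝ (fun y => fderiv ℝ n y 1) z 1 +
      fderiv ℝ (fun y => fderiv ℝ n y Complex.I) z Complex.I := by
  rw [fderiv_fderiv_apply hU hn hz, fderiv_fderiv_apply hU hn hz,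
    InnerProductSpace.laplacian_eq_iteratedFDeriv_complexPlane]
  simp [iteratedFDeriv_two_apply]

theorem fderiv_inv_smul {L : ℂ → Fin 5 → ℝ} {z : ℂ} (hL : DifferentiableAt ℝ L z) (h0 : L z 0 ≠ 0)
    (v : ℂ) : fderiv ℝ (fun w i => L w i / L w 0) z v =
      (L z 0)⁻¹ • fderiv ℝ L z v - (fderiv ℝ L z v 0 / L z 0 ^ 2) • L z := by
  have h := hasFDerivAt_pi'.1 hL.hasFDerivAt
  have h2 : HasFDerivAt (fun w i => L w i / L w 0) (ContinuousLinearMap.pi fun i : Fin 5 => _) z :=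
    hasFDerivAt_pi.2 fun i => by
      simp only [div_eq_mul_inv]
      exact (h i).mul ((hasFDerivAt_inv h0).comp z (h 0))
  rw [h2.fderiv]
  funext i
  simp
  field_simp
  ring

/-! ### The spherical lift at infinity -/

section

variable {U V : Set ℂ} {n : ℂ → Fin 4 → ℝ} {a : ℂ → ℂ} {d : ℂ → ℝ} {ε : ℝ} {L : ℂ → Fin 5 → ℝ}

/-- At infinity `n_x = 2 (Im a) e` and `n_y = 2 (Re a) e` for a unit vector `e`. The map `n` being
harmonic, the derivative of the lift is, in the direction of `e`, the rotated derivative of its last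
component; the remaining part of it is radial. -/
theorem IsDualLiftOn.exists_fderiv_eq (H : HarmonicPatch U n a) (D : RankDropPatch U n a d ε)
    (hV : IsOpen V) (hVU : V ⊆ U) (hL : IsDualLiftOn V n a d L) {z : ℂ} (hz : z ∈ V)
    (h4 : L z 4 = 0) : ∃ (e : Fin 4 → ℝ) (b c : ℝ), mink e e = 1 ∧ mink e (initFour (L z)) = 0 ∧
      initFour (fderiv ℝ L z 1) = fderiv ℝ L z Complex.I 4 • e + b • initFour (L z) ∧
      initFour (fderiv ℝ L z Complex.I) = -fderiv ℝ L z 1 4 • e + c • initFour (L z) := by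
  obtain ⟨hdz, hδ, -⟩ := hL.transversal z hz h4
  have hzU := hVU hz
  have HF := H.hopfFrame hzU
  obtain ⟨e', x, y, hp, hq⟩ := D.rank_le z hzU hdz
  have ha := D.root_ne z hzU hdz
  have hpar := HF.re_smul_eq_im_smul hp hq ha hδ
  clear hp hq e' x y
  have ha2 : 0 < (a z).re ^ 2 + (a z).im ^ 2 := by
    have := Complex.normSq_pos.2 ha
    rw [Complex.normSq_apply] at this
    nlinarith
  set p := fderiv ℝ n z 1 with hp
  set q := fderiv ℝ n z Complex.I with hq
  set α := (a z).re with hα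
  set β := (a z).im with hβ
  set X := initFour (L z) with hX
  have hL0 : X 0 ≠ 0 := hL.time_ne z hz
  have hLd : DifferentiableAt ℝ L z :=
    (hL.smooth.contDiffAt (hV.mem_nhds hz)).differentiableAt (by simp)
  have hXd : DifferentiableAt ℝ (fun w => initFour (L w)) z :=
    ((contDiffOn_initFour hL.smooth).contDiffAt (hV.mem_nhds hz)).differentiableAt (by simp)
  have hnd := H.differentiableAt hzU
  have hnvd : ∀ v : ℂ, DifferentiableAt ℝ (fun w => fderiv ℝ n w v) z := fun v =>
    ((H.smooth.fderiv_apply_const H.isOpen v).contDiffAt (H.isOpen.mem_nhds hzU)).differentiableAt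
      (by simp)
  have had : DifferentiableAt ℝ a z :=
    (H.smooth_root.contDiffAt (H.isOpen.mem_nhds hzU)).differentiableAt (by simp)
  set e : Fin 4 → ℝ := (1 / (2 * (α ^ 2 + β ^ 2))) • (β • p + α • q) with he
  have hpe : p = (2 * β) • e := by
    funext i
    have h1 : α * p i = β * q i := congrFun hpar i
    simp only [he, Pi.smul_apply, Pi.add_apply, smul_eq_mul]
    field_simp
    linear_combination α * h1
  have hqe : q = (2 * α) • e := by
    funext i
    have h1 : α * p i = β * q i := congrFun hpar i
    simp only [he, Pi.smul_apply, Pi.add_apply, smul_eq_mul]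
    field_simp
    linear_combination (-β) * h1
  have hee : mink e e = 1 := by
    have h1 : (mink p p + mink q q) / 4 - (α ^ 2 + β ^ 2) = 0 := hδ
    rw [hpe, hqe] at h1
    simp only [mink_smul_left, mink_smul_right] at h1
    have h2 : (α ^ 2 + β ^ 2) * (mink e e - 1) = 0 := by linear_combination h1
    linarith [(mul_eq_zero.1 h2).resolve_left ha2.ne']
  have horth_e : ∀ Y : Fin 4 → ℝ, mink p Y = 0 → mink q Y = 0 → mink e Y = 0 := by
    intro Y h1 h2
    rw [he, mink_smul_left, mink_add_left, mink_smul_left, mink_smul_left, h1, h2]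
    ring
  have hpX : mink p X = 0 := by rw [hL.pair_fst z hz, h4, mul_zero]
  have hqX : mink q X = 0 := by rw [hL.pair_snd z hz, h4, mul_zero]
  have heX : mink e X = 0 := horth_e X hpX hqX
  have hne : mink (n z) e = 0 := by
    rw [mink_comm]
    refine horth_e _ ?_ ?_
    · rw [mink_comm, HF.orth_fst]
    · rw [mink_comm, HF.orth_snd]
  have hnX := hL.orth z hz
  have hXX : mink X X = 0 := by
    have := hL.light z hz
    rw [mink_eq_init_add_last, h4, mul_zero, add_zero] at this
    exact this
  -- derivatives of the defining relations
  have hnXv : ∀ v, mink (n z) (initFour (fderiv ℝ L z v)) = 0 := by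
    intro v
    have h1 : (fun w => mink (n w) (initFour (L w))) =ᶠ[nhds z] fun _ => 0 := by
      filter_upwards [hV.mem_nhds hz] with w hw using hL.orth w hw
    have h2 := fderiv_mink hnd hXd v
    rw [h1.fderiv_eq, fderiv_initFour hLd, clm_complex_apply (fderiv ℝ n z) v, mink_add_left,
      mink_smul_left, mink_smul_left] at h2
    simp only [fderiv_fun_const, Pi.zero_apply, _root_.zero_apply] at h2
    linear_combination -h2 - v.re * hpX - v.im * hqX
  have hXXv : ∀ v, mink X (initFour (fderiv ℝ L z v)) = 0 := by
    intro v
    have h1 : (fun w => mink (L w) (L w)) =ᶠ[nhds z] fun _ => 0 := by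
      filter_upwards [hV.mem_nhds hz] with w hw using hL.light w hw
    have h2 := fderiv_mink hLd hLd v
    rw [h1.fderiv_eq, mink_comm (fderiv ℝ L z v), mink_eq_init_add_last, h4] at h2
    simp only [fderiv_fun_const, Pi.zero_apply, _root_.zero_apply] at h2
    change 0 = mink X (initFour (fderiv ℝ L z v)) + _ +
      (mink X (initFour (fderiv ℝ L z v)) + _) at h2
    linear_combination -1 / 2 * h2
  have hL4d : DifferentiableAt ℝ (fun w => L w 4) z := differentiableAt_pi.1 hLd 4
  have hpXv : ∀ v, mink (fderiv ℝ (fun w => fderiv ℝ n w 1) z v) X +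
      mink p (initFour (fderiv ℝ L z v)) = -2 * α * fderiv ℝ L z v 4 := by
    intro v
    have h1 : (fun w => mink (fderiv ℝ n w 1) (initFour (L w))) =ᶠ[nhds z]
        fun w => -2 * (a w).re * L w 4 := by
      filter_upwards [hV.mem_nhds hz] with w hw using hL.pair_fst w hw
    have h2 := fderiv_mink (hnvd 1) hXd v
    have hre : DifferentiableAt ℝ (fun w => -2 * (a w).re) z :=
      (differentiableAt_const _).mul (Complex.reCLM.differentiableAt.comp z had)
    rw [h1.fderiv_eq, fderiv_fun_mul hre hL4d, fderiv_initFour hLd] at h2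
    simp only [h4, zero_smul, add_zero, _root_.smul_apply, smul_eq_mul,
      fderiv_component hLd] at h2
    exact h2.symm
  have hqXv : ∀ v, mink (fderiv ℝ (fun w => fderiv ℝ n w Complex.I) z v) X +
      mink q (initFour (fderiv ℝ L z v)) = 2 * β * fderiv ℝ L z v 4 := by
    intro v
    have h1 : (fun w => mink (fderiv ℝ n w Complex.I) (initFour (L w))) =ᶠ[nhds z]
        fun w => 2 * (a w).im * L w 4 := by
      filter_upwards [hV.mem_nhds hz] with w hw using hL.pair_snd w hw
    have h2 := fderiv_mink (hnvd Complex.I) hXd v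
    have hre : DifferentiableAt ℝ (fun w => 2 * (a w).im) z :=
      (differentiableAt_const _).mul (Complex.imCLM.differentiableAt.comp z had)
    rw [h1.fderiv_eq, fderiv_fun_mul hre hL4d, fderiv_initFour hLd] at h2
    simp only [h4, zero_smul, add_zero, _root_.smul_apply, smul_eq_mul,
      fderiv_component hLd] at h2
    exact h2.symm
  obtain ⟨μ, hμ⟩ := H.harmonic z hzU
  rw [laplacian_eq_fderiv_fderiv H.isOpen H.smooth hzU] at hμ
  have hlap : mink (fderiv ℝ (fun w => fderiv ℝ n w 1) z 1) X +
      mink (fderiv ℝ (fun w => fderiv ℝ n w Complex.I) z Complex.I) X = 0 := by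
    rw [← mink_add_left, hμ, mink_smul_left, hnX, mul_zero]
  have hsymm := fderiv_fderiv_apply_comm H.isOpen H.smooth hzU 1 Complex.I
  set Xx := initFour (fderiv ℝ L z 1) with hXx
  set Xy := initFour (fderiv ℝ L z Complex.I) with hXy
  set τx := fderiv ℝ L z 1 4 with hτx
  set τy := fderiv ℝ L z Complex.I 4 with hτy
  have e1 : mink p Xx + mink q Xy = -2 * α * τx + 2 * β * τy := by
    linear_combination hpXv 1 + hqXv Complex.I - hlap
  have e2 : mink q Xx - mink p Xy = 2 * β * τx + 2 * α * τy := by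
    have h1 := hpXv Complex.I
    have h2 := hqXv 1
    rw [hsymm] at h1
    linear_combination h2 - h1
  rw [hpe, hqe] at e1 e2
  simp only [mink_smul_left] at e1 e2
  have hex : mink e Xx = τy := by
    have : (α ^ 2 + β ^ 2) * (mink e Xx - τy) = 0 := by
      linear_combination β / 2 * e1 + α / 2 * e2
    linarith [(mul_eq_zero.1 this).resolve_left ha2.ne']
  have hey : mink e Xy = -τx := by
    have : (α ^ 2 + β ^ 2) * (mink e Xy + τx) = 0 := by
      linear_combination α / 2 * e1 - β / 2 * e2
    linarith [(mul_eq_zero.1 this).resolve_left ha2.ne']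
  have hXe : mink X e = 0 := by rw [mink_comm, heX]
  have key : ∀ (Y : Fin 4 → ℝ) (t : ℝ), mink (n z) Y = 0 → mink X Y = 0 → mink e Y = t →
      ∃ b : ℝ, Y = t • e + b • X := by
    intro Y t h1 h2 h3
    refine ⟨_, sub_eq_iff_eq_add'.1 (eq_smul_of_orthogonal_lightlike (w := Y - t • e) HF.unit hee
      hne hXX hL0 hnX heX ?_ ?_ ?_)⟩
    · rw [mink_sub_right, mink_smul_right, h1, hne]; ring
    · rw [mink_sub_right, mink_smul_right, h3, hee]; ring
    · rw [mink_sub_right, mink_smul_right, h2, hXe]; ring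
  obtain ⟨b, hb⟩ := key Xx τy (hnXv 1) (hXXv 1) hex
  obtain ⟨c, hc⟩ := key Xy (-τx) (hnXv Complex.I) (hXXv Complex.I) hey
  exact ⟨e, b, c, hee, heX, hb, hc⟩

/-- The derivative of the spherical lift at infinity is conformal, and its image contains the normal
of the equatorial sphere. -/
theorem IsDualLiftOn.conformal_and_orthogonal (H : HarmonicPatch U n a)
    (D : RankDropPatch U n a d ε)
    (hV : IsOpen V) (hVU : V ⊆ U) (hL : IsDualLiftOn V n a d L) {z : ℂ} (hz : z ∈ V)
    (h4 : L z 4 = 0) : hopf (fun w i => L w i / L w 0) z = 0 ∧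
      ∃ v : ℂ, fderiv ℝ (fun w i => L w i / L w 0) z v ≠ 0 ∧ ∀ w : Fin 5 → ℝ, w 4 = 0 →
        mink (fderiv ℝ (fun w i => L w i / L w 0) z v) w = 0 := by
  obtain ⟨e, b, c, hee, heX, hx, hy⟩ := hL.exists_fderiv_eq H D hV hVU hz h4
  have hLd : DifferentiableAt ℝ L z :=
    (hL.smooth.contDiffAt (hV.mem_nhds hz)).differentiableAt (by simp)
  have h0 := hL.time_ne z hz
  have hXX : mink (initFour (L z)) (initFour (L z)) = 0 := by
    have := hL.light z hz
    rw [mink_eq_init_add_last, h4, mul_zero, add_zero] at this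
    exact this
  have hτ := (hL.transversal z hz h4).2.2
  set σ : ℂ → Fin 5 → ℝ := fun w i => L w i / L w 0 with hσ
  set X := initFour (L z) with hX
  set τx := fderiv ℝ L z 1 4 with hτx
  set τy := fderiv ℝ L z Complex.I 4 with hτy
  set g : Fin 4 → ℝ := e - (e 0 / L z 0) • X with hg
  have hgg : mink g g = 1 := by
    simp only [hg, mink_sub_left, mink_sub_right, mink_smul_left, mink_smul_right, hee, heX, hXX,
      mink_comm X e]
    ring
  have hgen : ∀ (v : ℂ) (t b : ℝ), initFour (fderiv ℝ L z v) = t • e + b • X →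
      initFour (fderiv ℝ σ z v) = (t / L z 0) • g := by
    intro v t b h
    have hv0 : fderiv ℝ L z v 0 = t * e 0 + b * L z 0 := congrFun h 0
    rw [hσ, fderiv_inv_smul hLd h0]
    funext i
    have hi : fderiv ℝ L z v i.castSucc = t * e i + b * L z i.castSucc := congrFun h i
    simp only [initFour, hg, hX, Pi.sub_apply, Pi.smul_apply, smul_eq_mul, hi, hv0]
    field_simp
    ring
  have hgen4 : ∀ v, fderiv ℝ σ z v 4 = fderiv ℝ L z v 4 / L z 0 := by
    intro v
    rw [hσ, fderiv_inv_smul hLd h0]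
    simp [h4]
    ring
  have hσx := hgen 1 _ _ hx
  have hσy := hgen Complex.I _ _ hy
  have hτne : 0 < τx ^ 2 + τy ^ 2 := by
    by_contra hcon
    apply hτ
    have h1 : τx = 0 := by nlinarith [sq_nonneg τx, sq_nonneg τy]
    have h2 : τy = 0 := by nlinarith [sq_nonneg τx, sq_nonneg τy]
    ext v
    rw [clm_complex_apply, fderiv_component hLd, fderiv_component hLd, ← hτx, ← hτy, h1, h2]
    simp
  have hmink : ∀ v w : ℂ, mink (fderiv ℝ σ z v) (fderiv ℝ σ z w) =
      mink (initFour (fderiv ℝ σ z v)) (initFour (fderiv ℝ σ z w)) +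
        fderiv ℝ L z v 4 / L z 0 * (fderiv ℝ L z w 4 / L z 0) := by
    intro v w
    rw [mink_eq_init_add_last, hgen4, hgen4]
    rfl
  refine ⟨?_, ⟨τx, τy⟩, fun hzero => ?_, fun w hw => ?_⟩
  · rw [hopf_eq, hmink, hmink, hmink, hσx, hσy]
    simp only [mink_smul_left, mink_smul_right, hgg, ← hτx, ← hτy]
    have h1 : τy / L z 0 * (τy / L z 0 * 1) + τx / L z 0 * (τx / L z 0) -
        (-τx / L z 0 * (-τx / L z 0 * 1) + τy / L z 0 * (τy / L z 0)) = 0 := by ring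
    have h2 : -τx / L z 0 * (τy / L z 0 * 1) + τx / L z 0 * (τy / L z 0) = 0 := by ring
    rw [h1, h2]
    simp
  · have h1 := congrFun hzero 4
    rw [clm_complex_apply] at h1
    simp only [Pi.add_apply, Pi.smul_apply, smul_eq_mul, hgen4, ← hτx, ← hτy, Pi.zero_apply] at h1
    have h2 : (τx ^ 2 + τy ^ 2) / L z 0 = 0 := by rw [← h1]; ring
    exact (div_ne_zero hτne.ne' h0) h2
  · have h1 : initFour (fderiv ℝ σ z ⟨τx, τy⟩) = 0 := by
      rw [clm_complex_apply]
      change τx • initFour (fderiv ℝ σ z 1) + τy • initFour (fderiv ℝ σ z Complex.I) = 0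
      rw [hσx, hσy]
      funext i
      simp only [Pi.add_apply, Pi.smul_apply, smul_eq_mul, Pi.zero_apply]
      ring
    rw [mink_eq_init_add_last, hw, mul_zero, add_zero]
    change mink (initFour (fderiv ℝ σ z ⟨τx, τy⟩)) _ = 0
    rw [h1, mink_zero_left]

end

/-! ### Wirtinger derivatives -/

section Wirtinger

variable {E : Type*} [NormedAddCommGroup E] [NormedSpace ℂ E]

/-- The Wirtinger derivative `∂F/∂z`. -/
def wirtinger (F : ℂ → E) (z : ℂ) : E :=
  (2⁻¹ : ℂ) • (fderiv ℝ F z 1 - Complex.I • fderiv ℝ F z Complex.I)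

/-- The Wirtinger derivative `∂F/∂z̄`. -/
def wirtingerBar (F : ℂ → E) (z : ℂ) : E :=
  (2⁻¹ : ℂ) • (fderiv ℝ F z 1 + Complex.I • fderiv ℝ F z Complex.I)

variable {U : Set ℂ} {F G : ℂ → E} {z : ℂ}

theorem ContDiffOn.wirtinger (hU : IsOpen U) (hF : ContDiffOn ℝ ∞ F U) :
    ContDiffOn ℝ ∞ (wirtinger F) U :=
  ((hF.fderiv_apply_const hU 1).sub
    ((hF.fderiv_apply_const hU Complex.I).const_smul Complex.I)).const_smul _

theorem ContDiffOn.wirtingerBar (hU : IsOpen U) (hF : ContDiffOn ℝ ∞ F U) :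
    ContDiffOn ℝ ∞ (wirtingerBar F) U :=
  ((hF.fderiv_apply_const hU 1).add
    ((hF.fderiv_apply_const hU Complex.I).const_smul Complex.I)).const_smul _

theorem ContDiffOn.differentiableAt_of_isOpen (hU : IsOpen U) (hF : ContDiffOn ℝ ∞ F U)
    (hz : z ∈ U) : DifferentiableAt ℝ F z :=
  (hF.contDiffAt (hU.mem_nhds hz)).differentiableAt (by simp)

theorem wirtinger_congr (hU : IsOpen U) (hz : z ∈ U) (h : ∀ w ∈ U, F w = G w) :
    wirtinger F z = wirtinger G z := by
  have : F =ᶠ[nhds z] G := by filter_upwards [hU.mem_nhds hz] with w hw using h w hw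
  rw [wirtinger, wirtinger, this.fderiv_eq]

theorem wirtingerBar_congr (hU : IsOpen U) (hz : z ∈ U) (h : ∀ w ∈ U, F w = G w) :
    wirtingerBar F z = wirtingerBar G z := by
  have : F =ᶠ[nhds z] G := by filter_upwards [hU.mem_nhds hz] with w hw using h w hw
  rw [wirtingerBar, wirtingerBar, this.fderiv_eq]

theorem wirtinger_const (c : E) : wirtinger (fun _ => c) z = 0 := by
  simp [wirtinger]

theorem wirtingerBar_const (c : E) : wirtingerBar (fun _ => c) z = 0 := by
  simp [wirtingerBar]

theorem wirtingerBar_sub (hF : DifferentiableAt ℝ F z) (hG : DifferentiableAt ℝ G z) :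
    wirtingerBar (fun w => F w - G w) z = wirtingerBar F z - wirtingerBar G z := by
  rw [wirtingerBar, fderiv_fun_sub hF hG]
  simp only [wirtingerBar, _root_.sub_apply, smul_sub, smul_add]
  abel

theorem wirtingerBar_smul {b : ℂ → ℂ} (hb : DifferentiableAt ℝ b z) (hG : DifferentiableAt ℝ G z) :
    wirtingerBar (fun w => b w • G w) z = wirtingerBar b z • G z + b z • wirtingerBar G z := by
  rw [wirtingerBar, fderiv_fun_smul hb hG]
  simp only [wirtingerBar, _root_.add_apply, _root_.smul_apply, ContinuousLinearMap.smulRight_apply,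
    smul_add, smul_smul, smul_eq_mul]
  module

theorem wirtinger_neg : wirtinger (fun w => -F w) z = -wirtinger F z := by
  rw [wirtinger, wirtinger, fderiv_fun_neg]
  simp only [_root_.neg_apply]
  module

theorem wirtingerBar_wirtinger (hU : IsOpen U) (hF : ContDiffOn ℝ ∞ F U) (hz : z ∈ U) :
    wirtingerBar (wirtinger F) z = (4⁻¹ : ℂ) • Laplacian.laplacian F z := by
  have h1 := (hF.fderiv_apply_const hU 1).differentiableAt_of_isOpen hU hz
  have h2 := (hF.fderiv_apply_const hU Complex.I).differentiableAt_of_isOpen hU hz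
  have h3 : ∀ v, fderiv ℝ (wirtinger F) z v = (2⁻¹ : ℂ) • (fderiv ℝ (fun w => fderiv ℝ F w 1) z v
      - Complex.I • fderiv ℝ (fun w => fderiv ℝ F w Complex.I) z v) := by
    intro v
    have h4 := (h1.hasFDerivAt.sub (h2.hasFDerivAt.const_smul Complex.I)).const_smul (2⁻¹ : ℂ)
    have h5 : fderiv ℝ (wirtinger F) z = _ := h4.fderiv
    rw [h5]
    rfl
  rw [wirtingerBar, h3, h3, laplacian_eq_fderiv_fderiv hU hF hz,
    fderiv_fderiv_apply_comm hU hF hz 1 Complex.I]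
  simp only [smul_add, smul_sub, smul_smul]
  have hI : Complex.I * (2⁻¹ * Complex.I) = -2⁻¹ := by
    linear_combination (2⁻¹ : ℂ) * Complex.I_mul_I
  rw [hI]
  module

theorem wirtinger_wirtingerBar (hU : IsOpen U) (hF : ContDiffOn ℝ ∞ F U) (hz : z ∈ U) :
    wirtinger (wirtingerBar F) z = (4⁻¹ : ℂ) • Laplacian.laplacian F z := by
  have h1 := (hF.fderiv_apply_const hU 1).differentiableAt_of_isOpen hU hz
  have h2 := (hF.fderiv_apply_const hU Complex.I).differentiableAt_of_isOpen hU hz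
  have h3 : ∀ v, fderiv ℝ (wirtingerBar F) z v = (2⁻¹ : ℂ) • (fderiv ℝ (fun w => fderiv ℝ F w 1) z v
      + Complex.I • fderiv ℝ (fun w => fderiv ℝ F w Complex.I) z v) := by
    intro v
    have h4 := (h1.hasFDerivAt.add (h2.hasFDerivAt.const_smul Complex.I)).const_smul (2⁻¹ : ℂ)
    have h5 : fderiv ℝ (wirtingerBar F) z = _ := h4.fderiv
    rw [h5]
    rfl
  rw [wirtinger, h3, h3, laplacian_eq_fderiv_fderiv hU hF hz,
    fderiv_fderiv_apply_comm hU hF hz 1 Complex.I]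
  simp only [smul_add, smul_sub, smul_smul]
  have hI : Complex.I * (2⁻¹ * Complex.I) = -2⁻¹ := by
    linear_combination (2⁻¹ : ℂ) * Complex.I_mul_I
  rw [hI]
  module

end Wirtinger

section WirtingerMink

variable {m : ℕ} {F G : ℂ → Fin (m + 1) → ℂ} {z : ℂ}

theorem wirtinger_mink (hF : DifferentiableAt ℝ F z) (hG : DifferentiableAt ℝ G z) :
    wirtinger (fun w => mink (F w) (G w)) z =
      mink (wirtinger F z) (G z) + mink (F z) (wirtinger G z) := by
  simp only [wirtinger, fderiv_mink hF hG, mink_smul_left, mink_smul_right, mink_sub_left,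
    mink_sub_right, smul_eq_mul]
  ring

theorem wirtingerBar_mink (hF : DifferentiableAt ℝ F z) (hG : DifferentiableAt ℝ G z) :
    wirtingerBar (fun w => mink (F w) (G w)) z =
      mink (wirtingerBar F z) (G z) + mink (F z) (wirtingerBar G z) := by
  simp only [wirtingerBar, fderiv_mink hF hG, mink_smul_left, mink_smul_right, mink_add_left,
    mink_add_right, smul_eq_mul]
  ring

end WirtingerMink

/-! ### Complexification -/

/-- The complexification of a real vector. -/
def complexify {m : ℕ} (x : Fin m → ℝ) : Fin m → ℂ := fun i => (x i : ℂ)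

theorem mink_complexify {m : ℕ} (x y : Fin (m + 1) → ℝ) :
    mink (complexify x) (complexify y) = ((mink x y : ℝ) : ℂ) := mink_ofReal x y

theorem complexify_add {m : ℕ} (x y : Fin m → ℝ) :
    complexify (x + y) = complexify x + complexify y := by
  funext i; simp [complexify]

theorem complexify_smul {m : ℕ} (c : ℝ) (x : Fin m → ℝ) :
    complexify (c • x) = (c : ℂ) • complexify x := by
  funext i; simp [complexify]

theorem fderiv_complexify {m : ℕ} {F : ℂ → Fin m → ℝ} {z : ℂ} (hF : DifferentiableAt ℝ F z)
    (v : ℂ) : fderiv ℝ (fun w => complexify (F w)) z v = complexify (fderiv ℝ F z v) := by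
  have h := hasFDerivAt_pi'.1 hF.hasFDerivAt
  have h2 : HasFDerivAt (fun w => complexify (F w)) (ContinuousLinearMap.pi fun i =>
      Complex.ofRealCLM.comp ((ContinuousLinearMap.proj i).comp (fderiv ℝ F z))) z :=
    hasFDerivAt_pi.2 fun i => Complex.ofRealCLM.hasFDerivAt.comp z (h i)
  rw [h2.fderiv]
  rfl

theorem ContDiffOn.complexify {m : ℕ} {U : Set ℂ} {F : ℂ → Fin m → ℝ} (hF : ContDiffOn ℝ ∞ F U) :
    ContDiffOn ℝ ∞ (fun w => complexify (F w)) U :=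
  contDiffOn_pi.2 fun i => Complex.ofRealCLM.contDiff.comp_contDiffOn (contDiffOn_pi.1 hF i)

theorem laplacian_complexify {m : ℕ} {U : Set ℂ} (hU : IsOpen U) {F : ℂ → Fin m → ℝ}
    (hF : ContDiffOn ℝ ∞ F U) {z : ℂ} (hz : z ∈ U) :
    Laplacian.laplacian (fun w => complexify (F w)) z = complexify (Laplacian.laplacian F z) := by
  have h : ∀ v, fderiv ℝ (fun y => fderiv ℝ (fun w => complexify (F w)) y v) z v =
      complexify (fderiv ℝ (fun y => fderiv ℝ F y v) z v) := by
    intro v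
    have h1 : (fun y => fderiv ℝ (fun w => complexify (F w)) y v) =ᶠ[nhds z]
        fun y => complexify (fderiv ℝ F y v) := by
      filter_upwards [hU.mem_nhds hz] with w hw
      exact fderiv_complexify ((hF.contDiffAt (hU.mem_nhds hw)).differentiableAt (by simp)) v
    rw [h1.fderiv_eq, fderiv_complexify]
    exact ((hF.fderiv_apply_const hU v).contDiffAt (hU.mem_nhds hz)).differentiableAt (by simp)
  rw [laplacian_eq_fderiv_fderiv hU hF.complexify hz, laplacian_eq_fderiv_fderiv hU hF hz, h, h,
    complexify_add]

theorem wirtinger_complexify {m : ℕ} {F : ℂ → Fin m → ℝ} {z : ℂ} (hF : DifferentiableAt ℝ F z) :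
    wirtinger (fun w => complexify (F w)) z = (2⁻¹ : ℂ) •
      (complexify (fderiv ℝ F z 1) - Complex.I • complexify (fderiv ℝ F z Complex.I)) := by
  rw [wirtinger, fderiv_complexify hF, fderiv_complexify hF]

theorem wirtingerBar_complexify {m : ℕ} {F : ℂ → Fin m → ℝ} {z : ℂ} (hF : DifferentiableAt ℝ F z) :
    wirtingerBar (fun w => complexify (F w)) z = (2⁻¹ : ℂ) •
      (complexify (fderiv ℝ F z 1) + Complex.I • complexify (fderiv ℝ F z Complex.I)) := by
  rw [wirtingerBar, fderiv_complexify hF, fderiv_complexify hF]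

theorem wirtinger_conj {b : ℂ → ℂ} {z : ℂ} (hb : DifferentiableAt ℝ b z) :
    wirtinger (fun w => starRingEnd ℂ (b w)) z = starRingEnd ℂ (wirtingerBar b z) := by
  have h : HasFDerivAt (fun w => starRingEnd ℂ (b w))
      ((Complex.conjCLE : ℂ →L[ℝ] ℂ).comp (fderiv ℝ b z)) z :=
    (Complex.conjCLE : ℂ →L[ℝ] ℂ).hasFDerivAt.comp z hb.hasFDerivAt
  rw [wirtinger, h.fderiv, wirtingerBar]
  simp only [smul_eq_mul, map_mul, map_add, map_inv₀, map_ofNat, Complex.conj_I,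
    ContinuousLinearMap.comp_apply, ContinuousLinearEquiv.coe_coe, Complex.conjCLE_apply]
  ring

/-- The Minkowski form on `ℂ⁴` is nondegenerate. -/
theorem eq_zero_of_mink_eq_zero {x₁ x₂ x₃ x₄ : Fin 4 → ℝ}
    (hdet : Matrix.det (Matrix.of ![x₁, x₂, x₃, x₄]) ≠ 0) {y : Fin 4 → ℂ}
    (h₁ : mink (complexify x₁) y = 0) (h₂ : mink (complexify x₂) y = 0)
    (h₃ : mink (complexify x₃) y = 0) (h₄ : mink (complexify x₄) y = 0) : y = 0 := by
  set A : Matrix (Fin 4) (Fin 4) ℂ := (Matrix.of ![x₁, x₂, x₃, x₄]).map Complex.ofRealHom with hA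
  have hA0 : A.det ≠ 0 := by
    have : A.det = Complex.ofRealHom (Matrix.det (Matrix.of ![x₁, x₂, x₃, x₄])) :=
      (RingHom.map_det Complex.ofRealHom _).symm
    rw [this]
    simpa using hdet
  set y' : Fin 4 → ℂ := ![-y 0, y 1, y 2, y 3] with hy'
  have key : ∀ x : Fin 4 → ℝ, ∑ j, (x j : ℂ) * y' j = mink (complexify x) y := by
    intro x
    rw [mink_four, Fin.sum_univ_four]
    simp [hy', complexify]
    ring
  have hAy : A.mulVec y' = 0 := by
    funext i
    fin_cases i
    · exact (key x₁).trans h₁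
    · exact (key x₂).trans h₂
    · exact (key x₃).trans h₃
    · exact (key x₄).trans h₄
  have hy0 := Matrix.eq_zero_of_mulVec_eq_zero hA0 hAy
  funext i
  have := congrFun hy0 i
  fin_cases i <;> simpa [hy'] using this

/-! ### Harmonicity of the dual map -/

section

variable {U : Set ℂ} {n : ℂ → Fin 4 → ℝ} {a : ℂ → ℂ}

/-- The square of the root `a` being holomorphic, so is `a`. -/
theorem HarmonicPatch.wirtingerBar_root (H : HarmonicPatch U n a) {z : ℂ} (hz : z ∈ U) :
    wirtingerBar a z = 0 := by
  have hN := H.smooth.complexify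
  have hP := hN.wirtinger H.isOpen
  have hsq : ∀ z ∈ U, a z * wirtingerBar a z = 0 := by
    intro z hz
    have hPd := hP.differentiableAt_of_isOpen H.isOpen hz
    have had := H.smooth_root.differentiableAt_of_isOpen H.isOpen hz
    have h1 : ∀ w ∈ U, mink (wirtinger (fun w => complexify (n w)) w)
        (wirtinger (fun w => complexify (n w)) w) = (-a w) • a w := by
      intro w hw
      have h := H.hopf_eq w hw
      have h2 : dz n w = wirtinger (fun w => complexify (n w)) w := by
        rw [wirtinger_complexify (H.differentiableAt hw)]
        funext i
        simp [dz, complexify]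
        ring
      rw [hopf, h2] at h
      rw [h, smul_eq_mul]
      ring
    have h2 := wirtingerBar_congr H.isOpen hz h1
    rw [wirtingerBar_mink hPd hPd, wirtingerBar_smul had.fun_neg had,
      wirtingerBar_wirtinger H.isOpen hN hz, laplacian_complexify H.isOpen H.smooth hz] at h2
    obtain ⟨μ, hμ⟩ := H.harmonic z hz
    have h3 : mink (complexify (n z)) (wirtinger (fun w => complexify (n w)) z) = 0 := by
      rw [wirtinger_complexify (H.differentiableAt hz)]
      simp only [mink_smul_right, mink_sub_right, mink_complexify, H.mink_fderiv hz]
      simp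
    have h4 : wirtingerBar (fun w => -a w) z = -wirtingerBar a z := by
      rw [wirtingerBar, wirtingerBar, fderiv_fun_neg]
      simp only [_root_.neg_apply]
      module
    rw [hμ, complexify_smul, mink_comm (wirtinger _ z), mink_smul_left, mink_smul_left, h3,
      h4] at h2
    simp only [smul_eq_mul] at h2
    linear_combination 1 / 2 * h2
  -- where the derivative does not vanish, neither does it nearby, so `a = 0` nearby
  by_contra hne
  have hc : ContinuousAt (wirtingerBar a) z :=
    (H.smooth_root.wirtingerBar H.isOpen).continuousOn.continuousAt (H.isOpen.mem_nhds hz)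
  have ha : a =ᶠ[nhds z] fun _ => 0 := by
    filter_upwards [hc.eventually_ne hne, H.isOpen.mem_nhds hz] with w hw hwU
    exact (mul_eq_zero.1 (hsq w hwU)).resolve_right hw
  apply hne
  rw [wirtingerBar, ha.fderiv_eq]
  simp

/-- The dual map `f` of a harmonic map `n` is harmonic. With `u = ∂̄n - ā f`, which is isotropic and
orthogonal to `n`, the derivative `∂f` is a combination of `n` and `u`; hence `⟨∂f, ∂̄u⟩ = 0`, which
is the component of the harmonic map equation along `∂̄n`. -/
theorem HarmonicPatch.laplacian_dual (H : HarmonicPatch U n a) {f : ℂ → Fin 4 → ℝ}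
    (hf : ContDiffOn ℝ ∞ f U) (hnf : ∀ z ∈ U, mink (n z) (f z) = 0)
    (hpf : ∀ z ∈ U, mink (fderiv ℝ n z 1) (f z) = -2 * (a z).re)
    (hqf : ∀ z ∈ U, mink (fderiv ℝ n z Complex.I) (f z) = 2 * (a z).im)
    (hff : ∀ z ∈ U, mink (f z) (f z) = -1) {z : ℂ} (hz : z ∈ U)
    (hcod : dualCodenom (fderiv ℝ n z 1) (fderiv ℝ n z Complex.I) (a z) ≠ 0)
    (hdet : Matrix.det (Matrix.of ![n z, f z, fderiv ℝ n z 1, fderiv ℝ n z Complex.I]) ≠ 0) :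
    Laplacian.laplacian f z = -mink (Laplacian.laplacian f z) (f z) • f z := by
  have hU := H.isOpen
  set N : ℂ → Fin 4 → ℂ := fun w => complexify (n w) with hNdef
  set φ : ℂ → Fin 4 → ℂ := fun w => complexify (f w) with hφdef
  set P := wirtinger N with hPdef
  set P' := wirtingerBar N with hP'def
  set g := wirtinger φ with hgdef
  set g' := wirtingerBar φ with hg'def
  set ac : ℂ → ℂ := fun w => starRingEnd ℂ (a w) with hacdef
  set u : ℂ → Fin 4 → ℂ := fun w => P' w - ac w • φ w with hudef
  have hN : ContDiffOn ℝ ∞ N U := H.smooth.complexify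
  have hφ : ContDiffOn ℝ ∞ φ U := hf.complexify
  have hP : ContDiffOn ℝ ∞ P U := hN.wirtinger hU
  have hP' : ContDiffOn ℝ ∞ P' U := hN.wirtingerBar hU
  have hg : ContDiffOn ℝ ∞ g U := hφ.wirtinger hU
  have ha := H.smooth_root
  have hac : ContDiffOn ℝ ∞ ac U := Complex.conjCLE.contDiff.comp_contDiffOn ha
  have hu : ContDiffOn ℝ ∞ u U := hP'.sub (hac.smul hφ)
  have hPw : ∀ w ∈ U, P w = (2⁻¹ : ℂ) • (complexify (fderiv ℝ n w 1) -
      Complex.I • complexify (fderiv ℝ n w Complex.I)) := fun w hw =>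
    wirtinger_complexify (H.differentiableAt hw)
  have hP'w : ∀ w ∈ U, P' w = (2⁻¹ : ℂ) • (complexify (fderiv ℝ n w 1) +
      Complex.I • complexify (fderiv ℝ n w Complex.I)) := fun w hw =>
    wirtingerBar_complexify (H.differentiableAt hw)
  have haw : ∀ w, a w = (a w).re + (a w).im * Complex.I := fun w => (Complex.re_add_im _).symm
  have hacw : ∀ w, ac w = (a w).re - (a w).im * Complex.I := fun w => by
    apply Complex.ext <;> simp [hacdef]
  have hI := Complex.I_sq
  -- the products of the vectors `n`, `f`, `∂n`, `∂̄n`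
  have rNφ : ∀ w ∈ U, mink (N w) (φ w) = 0 := fun w hw => by
    simp only [hNdef, hφdef, mink_complexify, hnf w hw, Complex.ofReal_zero]
  have rφφ : ∀ w ∈ U, mink (φ w) (φ w) = -1 := fun w hw => by
    simp only [hφdef, mink_complexify, hff w hw]
    simp
  have rNP' : ∀ w ∈ U, mink (N w) (P' w) = 0 := fun w hw => by
    rw [hP'w w hw]
    simp only [hNdef, mink_smul_right, mink_add_right, mink_complexify, H.mink_fderiv hw]
    simp
  have rNP : ∀ w ∈ U, mink (N w) (P w) = 0 := fun w hw => by
    rw [hPw w hw]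
    simp only [hNdef, mink_smul_right, mink_sub_right, mink_complexify, H.mink_fderiv hw]
    simp
  have rPφ : ∀ w ∈ U, mink (P w) (φ w) = -a w := fun w hw => by
    rw [hPw w hw, haw w]
    simp only [hφdef, mink_smul_left, mink_sub_left, mink_complexify, hpf w hw, hqf w hw]
    push_cast
    ring
  have rP'φ : ∀ w ∈ U, mink (P' w) (φ w) = -ac w := fun w hw => by
    rw [hP'w w hw, hacw w]
    simp only [hφdef, mink_smul_left, mink_add_left, mink_complexify, hpf w hw, hqf w hw]
    push_cast
    ring
  have rP'P' : ∀ w ∈ U, mink (P' w) (P' w) = -(ac w) ^ 2 := fun w hw => by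
    have hF := H.hopfFrame hw
    have h1 := congrArg (fun x : ℝ => (x : ℂ)) hF.diff
    have h2 := congrArg (fun x : ℝ => (x : ℂ)) hF.mixed
    push_cast at h1 h2
    rw [hP'w w hw, hacw w]
    simp only [mink_smul_left, mink_add_left, mink_smul_right, mink_add_right, mink_complexify,
      mink_comm (fderiv ℝ n w Complex.I) (fderiv ℝ n w 1)]
    linear_combination 1 / 4 * h1 + Complex.I / 2 * h2 +
      ((mink (fderiv ℝ n w Complex.I) (fderiv ℝ n w Complex.I) : ℝ) / 4 +
        ((a w).im : ℂ) ^ 2) * hI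
  have rPP' : mink (P z) (P' z) = (dualCodenom (fderiv ℝ n z 1) (fderiv ℝ n z Complex.I) (a z) : ℝ)
      - a z * ac z := by
    have hsq : a z * ac z = ((a z).re : ℂ) ^ 2 + ((a z).im : ℂ) ^ 2 := by
      rw [hacdef, Complex.mul_conj, Complex.normSq_apply]
      push_cast
      ring
    rw [hPw z hz, hP'w z hz, hsq, dualCodenom]
    simp only [mink_smul_left, mink_smul_right, mink_add_right, mink_complexify,
      mink_sub_left, mink_comm (fderiv ℝ n z Complex.I) (fderiv ℝ n z 1)]
    push_cast
    linear_combination (-(mink (fderiv ℝ n z Complex.I) (fderiv ℝ n z Complex.I) : ℝ) / 4) * hI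
  have hNd : ∀ w ∈ U, DifferentiableAt ℝ N w := fun w hw => hN.differentiableAt_of_isOpen hU hw
  have hφd : ∀ w ∈ U, DifferentiableAt ℝ φ w := fun w hw => hφ.differentiableAt_of_isOpen hU hw
  have hP'd : ∀ w ∈ U, DifferentiableAt ℝ P' w := fun w hw => hP'.differentiableAt_of_isOpen hU hw
  have hgd : ∀ w ∈ U, DifferentiableAt ℝ g w := fun w hw => hg.differentiableAt_of_isOpen hU hw
  have hud : ∀ w ∈ U, DifferentiableAt ℝ u w := fun w hw => hu.differentiableAt_of_isOpen hU hw
  have had : ∀ w ∈ U, DifferentiableAt ℝ a w := fun w hw => ha.differentiableAt_of_isOpen hU hw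
  have hacd : ∀ w ∈ U, DifferentiableAt ℝ ac w := fun w hw => hac.differentiableAt_of_isOpen hU hw
  have hlapN : ∀ w ∈ U, ∃ c : ℂ, wirtinger P' w = c • N w := fun w hw => by
    obtain ⟨μ, hμ⟩ := H.harmonic w hw
    refine ⟨4⁻¹ * μ, ?_⟩
    rw [hP'def, wirtinger_wirtingerBar hU hN hw, laplacian_complexify hU H.smooth hw, hμ,
      complexify_smul, smul_smul]
  have hacz : ∀ w ∈ U, wirtinger ac w = 0 := fun w hw => by
    rw [hacdef, wirtinger_conj (had w hw), H.wirtingerBar_root hw, map_zero]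
  -- the products of `∂f` with `f`, `n` and `∂̄n`
  have sφ : ∀ w ∈ U, mink (g w) (φ w) = 0 := fun w hw => by
    have h := wirtinger_congr hU hw rφφ
    rw [wirtinger_mink (hφd w hw) (hφd w hw), wirtinger_const, mink_comm (φ w)] at h
    linear_combination 1 / 2 * h
  have sN : ∀ w ∈ U, mink (g w) (N w) = a w := fun w hw => by
    have h := wirtinger_congr hU hw rNφ
    rw [wirtinger_mink (hNd w hw) (hφd w hw), wirtinger_const, mink_comm (N w)] at h
    have h2 := rPφ w hw
    linear_combination h - h2
  have sP' : ∀ w ∈ U, mink (g w) (P' w) = 0 := fun w hw => by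
    have h := wirtinger_congr hU hw rP'φ
    obtain ⟨c, hc⟩ := hlapN w hw
    rw [wirtinger_mink (hP'd w hw) (hφd w hw), wirtinger_neg, hacz w hw, hc, mink_smul_left,
      rNφ w hw, mink_comm (P' w)] at h
    linear_combination h
  set Y := wirtingerBar g z with hYdef
  have tφ : mink Y (φ z) = -mink (g z) (g' z) := by
    have h := wirtingerBar_congr hU hz sφ
    rw [wirtingerBar_mink (hgd z hz) (hφd z hz), wirtingerBar_const] at h
    linear_combination h
  have tN : mink Y (N z) = 0 := by
    have h := wirtingerBar_congr hU hz sN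
    rw [wirtingerBar_mink (hgd z hz) (hNd z hz), H.wirtingerBar_root hz] at h
    have h2 := sP' z hz
    linear_combination h - h2
  have tP' : mink Y (P' z) = -mink (g z) (wirtingerBar P' z) := by
    have h := wirtingerBar_congr hU hz sP'
    rw [wirtingerBar_mink (hgd z hz) (hP'd z hz), wirtingerBar_const] at h
    linear_combination h
  -- the isotropic vector `u`
  have ruu : ∀ w ∈ U, mink (u w) (u w) = 0 := fun w hw => by
    simp only [hudef, mink_sub_left, mink_sub_right, mink_smul_left, mink_smul_right, rP'P' w hw,
      rφφ w hw, mink_comm (φ w) (P' w), rP'φ w hw]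
    ring
  have rNu : ∀ w ∈ U, mink (N w) (u w) = 0 := fun w hw => by
    simp only [hudef, mink_sub_right, mink_smul_right, rNP' w hw, rNφ w hw]
    ring
  have rP'u : mink (P' z) (u z) = 0 := by
    simp only [hudef, mink_sub_right, mink_smul_right, rP'P' z hz, rP'φ z hz]
    ring
  have rφu : mink (φ z) (u z) = 0 := by
    simp only [hudef, mink_sub_right, mink_smul_right, rφφ z hz, mink_comm (φ z) (P' z), rP'φ z hz]
    ring
  have rPu : mink (P z) (u z) ≠ 0 := by
    have : mink (P z) (u z) =
        (dualCodenom (fderiv ℝ n z 1) (fderiv ℝ n z Complex.I) (a z) : ℝ) := by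
      simp only [hudef, mink_sub_right, mink_smul_right, rPP', rPφ z hz]
      ring
    rw [this]
    exact_mod_cast hcod
  have duu : mink (u z) (wirtingerBar u z) = 0 := by
    have h := wirtingerBar_congr hU hz ruu
    rw [wirtingerBar_mink (hud z hz) (hud z hz), wirtingerBar_const,
      mink_comm (wirtingerBar u z)] at h
    linear_combination 1 / 2 * h
  have dNu : mink (N z) (wirtingerBar u z) = 0 := by
    have h := wirtingerBar_congr hU hz rNu
    rw [wirtingerBar_mink (hNd z hz) (hud z hz), wirtingerBar_const] at h
    linear_combination h - rP'u
  have hreal : ∀ y : Fin 4 → ℂ, mink (N z) y = 0 → mink (φ z) y = 0 → mink (P z) y = 0 →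
      mink (P' z) y = 0 → y = 0 := by
    intro y h1 h2 h3 h4
    rw [hPw z hz, mink_smul_left, mink_sub_left, mink_smul_left] at h3
    rw [hP'w z hz, mink_smul_left, mink_add_left, mink_smul_left] at h4
    refine eq_zero_of_mink_eq_zero hdet h1 h2 ?_ ?_
    · linear_combination h3 + h4
    · linear_combination Complex.I * h3 - Complex.I * h4 +
        mink (complexify (fderiv ℝ n z Complex.I)) y * hI
  have hgu : g z = a z • N z + (mink (P z) (g z) / mink (P z) (u z)) • u z := by
    have rNN : mink (N z) (N z) = 1 := by
      simp only [hNdef, mink_complexify, H.unit z hz, Complex.ofReal_one]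
    have h := hreal (g z - (a z • N z + (mink (P z) (g z) / mink (P z) (u z)) • u z)) ?_ ?_ ?_ ?_
    · exact sub_eq_zero.1 h
    · rw [mink_sub_right, mink_add_right, mink_smul_right, mink_smul_right, rNu z hz, rNN,
        mink_comm, sN z hz]
      ring
    · rw [mink_sub_right, mink_add_right, mink_smul_right, mink_smul_right, rφu,
        mink_comm (φ z) (N z), rNφ z hz, mink_comm, sφ z hz]
      ring
    · rw [mink_sub_right, mink_add_right, mink_smul_right, mink_smul_right,
        mink_comm (P z) (N z), rNP z hz, div_mul_cancel₀ _ rPu]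
      ring
    · rw [mink_sub_right, mink_add_right, mink_smul_right, mink_smul_right,
        mink_comm (P' z) (N z), rNP' z hz, rP'u, mink_comm, sP' z hz]
      ring
  have gdu : mink (g z) (wirtingerBar u z) = 0 := by
    rw [hgu, mink_add_left, mink_smul_left, mink_smul_left, duu, dNu]
    ring
  have tP'' : mink Y (P' z) = ac z * mink Y (φ z) := by
    have h1 : wirtingerBar u z =
        wirtingerBar P' z - (wirtingerBar ac z • φ z + ac z • g' z) := by
      rw [hudef, wirtingerBar_sub (hP'd z hz) ((hacd z hz).fun_smul (hφd z hz)),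
        wirtingerBar_smul (hacd z hz) (hφd z hz)]
    rw [h1, mink_sub_right, mink_add_right, mink_smul_right, mink_smul_right, sφ z hz] at gdu
    rw [tP', tφ]
    linear_combination -gdu
  -- back to the real vector `Δf`
  set y : Fin 4 → ℝ := Laplacian.laplacian f z + mink (Laplacian.laplacian f z) (f z) • f z with hy
  have hYy : complexify (Laplacian.laplacian f z) = (4 : ℂ) • Y := by
    rw [hYdef, hgdef, wirtingerBar_wirtinger hU hφ hz, laplacian_complexify hU hf hz, smul_smul]
    norm_num
  have hyc : complexify y = (4 : ℂ) • (Y + mink Y (φ z) • φ z) := by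
    have h1 : ((mink (Laplacian.laplacian f z) (f z) : ℝ) : ℂ) = 4 * mink Y (φ z) := by
      rw [← mink_complexify, hYy, mink_smul_left]
    rw [hy, complexify_add, complexify_smul, h1, hYy]
    module
  have hP'y : mink (P' z) (complexify y) = 0 := by
    rw [hyc, mink_smul_right, mink_add_right, mink_smul_right, mink_comm (P' z) Y, tP'', rP'φ z hz]
    ring
  rw [hP'w z hz] at hP'y
  simp only [mink_smul_left, mink_add_left, mink_complexify] at hP'y
  have hre := congrArg Complex.re hP'y
  have him := congrArg Complex.im hP'y
  simp at hre him
  have hy0 : complexify y = 0 := by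
    refine eq_zero_of_mink_eq_zero hdet ?_ ?_ ?_ ?_
    · change mink (N z) _ = 0
      rw [hyc, mink_smul_right, mink_add_right, mink_smul_right, mink_comm (N z) Y, tN, rNφ z hz]
      ring
    · change mink (φ z) _ = 0
      rw [hyc, mink_smul_right, mink_add_right, mink_smul_right, mink_comm (φ z) Y, rφφ z hz]
      ring
    · rw [mink_complexify, hre, Complex.ofReal_zero]
    · rw [mink_complexify, him, Complex.ofReal_zero]
  have hy00 : y = 0 := by
    funext i
    have := congrFun hy0 i
    simpa [complexify] using this
  rw [hy] at hy00
  rw [neg_smul]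
  exact eq_neg_of_add_eq_zero_left hy00

end

section

variable {U V : Set ℂ} {n : ℂ → Fin 4 → ℝ} {a : ℂ → ℂ} {d : ℂ → ℝ} {ε : ℝ} {L : ℂ → Fin 5 → ℝ}

theorem HarmonicPatch.mono (H : HarmonicPatch U n a) (hV : IsOpen V) (hVU : V ⊆ U) :
    HarmonicPatch V n a :=
  ⟨hV, H.smooth.mono hVU, H.smooth_root.mono hVU, fun z hz => H.unit z (hVU hz),
    fun z hz => H.hopf_eq z (hVU hz), fun z hz => H.harmonic z (hVU hz)⟩

theorem RankDropPatch.mono (D : RankDropPatch U n a d ε) (hVU : V ⊆ U) :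
    RankDropPatch V n a d ε :=
  ⟨D.smooth.mono hVU, D.sign, fun z hz => D.sq_eq z (hVU hz), fun z hz => D.regular z (hVU hz),
    fun z hz => D.root_ne z (hVU hz), fun z hz => D.rank_le z (hVU hz)⟩

/-- The affine part `(x₀, …, x₃) / x₄` of a vector of `ℝ^{1,4}`. -/
def affinePart (x : Fin 5 → ℝ) : Fin 4 → ℝ := fun i => x i.castSucc / x 4

theorem affinePart_eq (x : Fin 5 → ℝ) : affinePart x = (x 4)⁻¹ • initFour x :=
  funext fun i => by simp [affinePart, initFour, div_eq_inv_mul]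

theorem affinePart_smul {r : ℝ} (hr : r ≠ 0) (x : Fin 5 → ℝ) :
    affinePart (r • x) = affinePart x :=
  funext fun _ => mul_div_mul_left _ _ hr

theorem IsDualLiftOn.contDiffOn_affinePart (hL : IsDualLiftOn V n a d L) :
    ContDiffOn ℝ ∞ (fun w => affinePart (L w)) (V ∩ {w | L w 4 ≠ 0}) := by
  have h := hL.smooth.mono (Set.inter_subset_left : V ∩ {w | L w 4 ≠ 0} ⊆ V)
  rw [contDiffOn_pi] at h
  exact contDiffOn_pi.2 fun i => (h i.castSucc).div (h 4) fun w hw => hw.2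

theorem IsDualLiftOn.mink_affinePart (hL : IsDualLiftOn V n a d L) {z : ℂ} (hz : z ∈ V) :
    mink (n z) (affinePart (L z)) = 0 := by
  rw [affinePart_eq, mink_smul_right, hL.orth z hz, mul_zero]

theorem IsDualLiftOn.mink_fst_affinePart (hL : IsDualLiftOn V n a d L) {z : ℂ} (hz : z ∈ V)
    (h4 : L z 4 ≠ 0) : mink (fderiv ℝ n z 1) (affinePart (L z)) = -2 * (a z).re := by
  rw [affinePart_eq, mink_smul_right, hL.pair_fst z hz]
  field_simp

theorem IsDualLiftOn.mink_snd_affinePart (hL : IsDualLiftOn V n a d L) {z : ℂ} (hz : z ∈ V)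
    (h4 : L z 4 ≠ 0) : mink (fderiv ℝ n z Complex.I) (affinePart (L z)) = 2 * (a z).im := by
  rw [affinePart_eq, mink_smul_right, hL.pair_snd z hz]
  field_simp

theorem IsDualLiftOn.mink_affinePart_self (hL : IsDualLiftOn V n a d L) {z : ℂ} (hz : z ∈ V)
    (h4 : L z 4 ≠ 0) : mink (affinePart (L z)) (affinePart (L z)) = -1 := by
  have h := hL.light z hz
  rw [mink_eq_init_add_last] at h
  change mink (initFour (L z)) (initFour (L z)) + _ = 0 at h
  rw [affinePart_eq, mink_smul_right, mink_smul_left, eq_neg_of_add_eq_zero_left h]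
  field_simp

/-- The dual map is positively oriented wherever `n` is an immersion. -/
theorem IsDualLiftOn.det_pos (H : HarmonicPatch V n a) (D : RankDropPatch V n a d ε)
    (hL : IsDualLiftOn V n a d L) {z : ℂ} (hz : z ∈ V) (hdz : d z ≠ 0) :
    0 < Matrix.det (Matrix.of ![n z, affinePart (L z), fderiv ℝ n z 1,
      fderiv ℝ n z Complex.I]) := by
  obtain ⟨r, hr, hLr⟩ := hL.eq_smul z hz hdz
  have hpos := D.dualDenom_mul_dualCodenom_pos H hz hdz
  set δ := dualDenom (fderiv ℝ n z 1) (fderiv ℝ n z Complex.I) (a z) with hδ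
  set κ := dualCodenom (fderiv ℝ n z 1) (fderiv ℝ n z Complex.I) (a z) with hκ
  have hδ0 : δ ≠ 0 := fun h => by simp [h] at hpos
  have hκ0 : κ ≠ 0 := fun h => by simp [h] at hpos
  have hdet := (H.hopfFrame hz).det_dualNumer (Real.sign κ)
  rw [det_eq_neg_mink_crossVec, ← hδ, ← hκ] at hdet
  rw [hLr, affinePart_smul hr, dualLiftAt, affinePart_eq, initFour_dualLift, dualLift_last,
    det_eq_neg_mink_crossVec, mink_smul_right, ← mul_neg, hdet, ← hδ]
  have h2 : δ⁻¹ * (2 * Real.sign κ * (δ * κ)) = 2 * (Real.sign κ * κ) := by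
    field_simp
  rw [h2]
  exact mul_pos two_pos (Real.sign_mul_pos_of_ne_zero κ hκ0)

/-- The affine part of the dual lift satisfies the harmonic map equation wherever it is finite: on
the curve `d = 0` by continuity. -/
theorem IsDualLiftOn.laplacian_affinePart (H : HarmonicPatch V n a) (D : RankDropPatch V n a d ε)
    (hL : IsDualLiftOn V n a d L) {z : ℂ} (hz : z ∈ V) (h4 : L z 4 ≠ 0) :
    Laplacian.laplacian (fun w => affinePart (L w)) z =
      -mink (Laplacian.laplacian (fun w => affinePart (L w)) z) (affinePart (L z)) •
        affinePart (L z) := by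
  set W := V ∩ {w | L w 4 ≠ 0} with hW
  have hWo : IsOpen W := by
    have h1 : ContinuousOn (fun w => L w 4) V := (contDiffOn_pi.1 hL.smooth 4).continuousOn
    exact h1.isOpen_inter_preimage H.isOpen isOpen_ne
  have hWV : W ⊆ V := Set.inter_subset_left
  have hf := hL.contDiffOn_affinePart
  have hlap : ContDiffOn ℝ ∞ (Laplacian.laplacian fun w => affinePart (L w)) W := by
    refine ContDiffOn.congr ?_ fun w hw => laplacian_eq_fderiv_fderiv hWo hf hw
    exact ((hf.fderiv_apply_const hWo 1).fderiv_apply_const hWo 1).add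
      ((hf.fderiv_apply_const hWo Complex.I).fderiv_apply_const hWo Complex.I)
  refine D.eqOn_of_eqOn_ne_zero hWo hWV hlap.continuousOn
    ((hlap.mink hf).neg.smul hf).continuousOn (fun w hw hdw => ?_) z ⟨hz, h4⟩
  have hpos := D.dualDenom_mul_dualCodenom_pos H hw.1 hdw
  refine (H.mono hWo hWV).laplacian_dual hf (fun y hy => hL.mink_affinePart hy.1)
    (fun y hy => hL.mink_fst_affinePart hy.1 hy.2) (fun y hy => hL.mink_snd_affinePart hy.1 hy.2)
    (fun y hy => hL.mink_affinePart_self hy.1 hy.2) hw (fun h => ?_) (hL.det_pos H D hw.1 hdw).ne'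
  rw [h] at hpos
  simp at hpos

end

/-! ### Charts -/

section Charts

variable {M : Type*} [TopologicalSpace M]

theorem isOpen_transition_source (φ ψ : OpenPartialHomeomorph M ℂ) :
    IsOpen (φ.symm.trans ψ).source := (φ.symm.trans ψ).open_source

theorem mem_transition_source {φ ψ : OpenPartialHomeomorph M ℂ} {z : ℂ} :
    z ∈ (φ.symm.trans ψ).source ↔ z ∈ φ.target ∧ φ.symm z ∈ ψ.source := by
  simp

theorem transition_mem_source {φ ψ : OpenPartialHomeomorph M ℂ} {z : ℂ}
    (hz : z ∈ (φ.symm.trans ψ).source) : ψ (φ.symm z) ∈ (ψ.symm.trans φ).source := by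
  rw [mem_transition_source] at hz ⊢
  exact ⟨ψ.map_source hz.2, by rw [ψ.left_inv hz.2]; exact φ.map_target hz.1⟩

theorem comp_symm_eventuallyEq {Y : Type*} (N : M → Y) {φ ψ : OpenPartialHomeomorph M ℂ} {z : ℂ}
    (hz : z ∈ (φ.symm.trans ψ).source) :
    N ∘ φ.symm =ᶠ[nhds z] (N ∘ ψ.symm) ∘ (ψ ∘ φ.symm) := by
  filter_upwards [(isOpen_transition_source φ ψ).mem_nhds hz] with w hw
  rw [mem_transition_source] at hw
  simp [ψ.left_inv hw.2]

variable [ChartedSpace ℂ M]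

theorem contDiffOn_transition {𝕜 : Type*} [NontriviallyNormedField 𝕜] [NormedSpace 𝕜 ℂ]
    {k : WithTop ℕ∞} [IsManifold 𝓘(𝕜, ℂ) k M] {φ ψ : OpenPartialHomeomorph M ℂ}
    (hφ : φ ∈ IsManifold.maximalAtlas 𝓘(𝕜, ℂ) k M) (hψ : ψ ∈ IsManifold.maximalAtlas 𝓘(𝕜, ℂ) k M) :
    ContDiffOn 𝕜 k (ψ ∘ φ.symm) (φ.symm.trans ψ).source :=
  contMDiffOn_iff_contDiffOn.1
    (contMDiffOn_of_mem_contDiffGroupoid (IsManifold.compatible_of_mem_maximalAtlas hφ hψ))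

variable (M) in
/-- A Riemann surface is a real smooth surface. -/
theorem isManifold_real_of_complex [IsManifold 𝓘(ℂ, ℂ) ω M] : IsManifold 𝓘(ℝ, ℂ) ∞ M := by
  refine isManifold_of_contDiffOn _ _ _ fun e e' he he' => ?_
  have h := contDiffOn_transition (𝕜 := ℂ) (k := ω) (M := M)
    (IsManifold.subset_maximalAtlas he) (IsManifold.subset_maximalAtlas he')
  have h2 : ContDiffOn ℝ ∞ (e' ∘ e.symm) (e.symm.trans e').source :=
    (h.restrict_scalars ℝ).of_le le_top
  simpa using h2

theorem contDiffOn_comp_symm {m : ℕ} {φ : OpenPartialHomeomorph M ℂ} {N : M → Fin m → ℝ}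
    (hN : ContMDiff 𝓘(ℝ, ℂ) 𝓘(ℝ, Fin m → ℝ) ∞ N)
    (hφ : φ ∈ IsManifold.maximalAtlas 𝓘(ℝ, ℂ) ∞ M) : ContDiffOn ℝ ∞ (N ∘ φ.symm) φ.target :=
  contMDiffOn_iff_contDiffOn.1 (hN.comp_contMDiffOn (contMDiffOn_symm_of_mem_maximalAtlas hφ))

section Real

variable [IsManifold 𝓘(ℝ, ℂ) ∞ M] {φ ψ : OpenPartialHomeomorph M ℂ}

theorem differentiableAt_transition (hφ : φ ∈ IsManifold.maximalAtlas 𝓘(ℝ, ℂ) ∞ M)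
    (hψ : ψ ∈ IsManifold.maximalAtlas 𝓘(ℝ, ℂ) ∞ M) {z : ℂ} (hz : z ∈ (φ.symm.trans ψ).source) :
    DifferentiableAt ℝ (ψ ∘ φ.symm) z :=
  ((contDiffOn_transition hφ hψ).contDiffAt
    ((isOpen_transition_source φ ψ).mem_nhds hz)).differentiableAt (by simp)

theorem fderiv_transition_comp (hφ : φ ∈ IsManifold.maximalAtlas 𝓘(ℝ, ℂ) ∞ M)
    (hψ : ψ ∈ IsManifold.maximalAtlas 𝓘(ℝ, ℂ) ∞ M) {z : ℂ} (hz : z ∈ (φ.symm.trans ψ).source)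
    (v : ℂ) :
    fderiv ℝ (φ ∘ ψ.symm) (ψ (φ.symm z)) (fderiv ℝ (ψ ∘ φ.symm) z v) = v := by
  have h1 := differentiableAt_transition hφ hψ hz
  have h2 := differentiableAt_transition hψ hφ (transition_mem_source hz)
  have h3 : (φ ∘ ψ.symm) ∘ (ψ ∘ φ.symm) =ᶠ[nhds z] id := by
    filter_upwards [(isOpen_transition_source φ ψ).mem_nhds hz] with w hw
    rw [mem_transition_source] at hw
    simp [ψ.left_inv hw.2, φ.right_inv hw.1]
  have h4 := h3.fderiv_eq (𝕜 := ℝ)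
  rw [fderiv_comp z h2 h1, fderiv_id] at h4
  exact congrArg (fun A : ℂ →L[ℝ] ℂ => A v) h4

theorem fderiv_comp_symm {m : ℕ} {N : M → Fin m → ℝ}
    (hN : ContMDiff 𝓘(ℝ, ℂ) 𝓘(ℝ, Fin m → ℝ) ∞ N)
    (hφ : φ ∈ IsManifold.maximalAtlas 𝓘(ℝ, ℂ) ∞ M)
    (hψ : ψ ∈ IsManifold.maximalAtlas 𝓘(ℝ, ℂ) ∞ M) {z : ℂ} (hz : z ∈ (φ.symm.trans ψ).source)
    (v : ℂ) :
    fderiv ℝ (N ∘ φ.symm) z v =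
      fderiv ℝ (N ∘ ψ.symm) (ψ (φ.symm z)) (fderiv ℝ (ψ ∘ φ.symm) z v) := by
  have h1 := differentiableAt_transition hφ hψ hz
  have hzψ : ψ (φ.symm z) ∈ ψ.target := ψ.map_source (mem_transition_source.1 hz).2
  have h2 : DifferentiableAt ℝ (N ∘ ψ.symm) (ψ (φ.symm z)) :=
    ((contDiffOn_comp_symm hN hψ).contDiffAt (ψ.open_target.mem_nhds hzψ)).differentiableAt
      (by simp)
  rw [(comp_symm_eventuallyEq N hz).fderiv_eq, fderiv_comp z h2 h1]
  rfl

/-- The Jacobian determinant of a map between open subsets of the plane. -/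
def planeJacobian (t : ℂ → ℂ) (z : ℂ) : ℝ :=
  (fderiv ℝ t z 1).re * (fderiv ℝ t z Complex.I).im -
    (fderiv ℝ t z 1).im * (fderiv ℝ t z Complex.I).re

theorem planeJacobian_transition_ne_zero (hφ : φ ∈ IsManifold.maximalAtlas 𝓘(ℝ, ℂ) ∞ M)
    (hψ : ψ ∈ IsManifold.maximalAtlas 𝓘(ℝ, ℂ) ∞ M) {z : ℂ} (hz : z ∈ (φ.symm.trans ψ).source) :
    planeJacobian (ψ ∘ φ.symm) z ≠ 0 := by
  intro hJ
  rw [planeJacobian] at hJ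
  set A := fderiv ℝ (ψ ∘ φ.symm) z with hA
  have hker : ∀ v, A v = 0 → v = 0 := fun v hv => by
    rw [← fderiv_transition_comp hφ hψ hz v, ← hA, hv, map_zero]
  have h1 : A ⟨(A Complex.I).re, -(A 1).re⟩ = 0 := by
    rw [clm_complex_apply]
    apply Complex.ext
    · simp; ring
    · simp; linarith
  have h2 : A ⟨(A Complex.I).im, -(A 1).im⟩ = 0 := by
    rw [clm_complex_apply]
    apply Complex.ext
    · simp; linarith
    · simp; ring
  have h3 := congrArg Complex.im (hker _ h1)
  have h4 := congrArg Complex.im (hker _ h2)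
  simp at h3 h4
  exact one_ne_zero (hker 1 (Complex.ext h3 h4))

theorem gramDet_comp_symm {m : ℕ} {N : M → Fin (m + 1) → ℝ}
    (hN : ContMDiff 𝓘(ℝ, ℂ) 𝓘(ℝ, Fin (m + 1) → ℝ) ∞ N)
    (hφ : φ ∈ IsManifold.maximalAtlas 𝓘(ℝ, ℂ) ∞ M)
    (hψ : ψ ∈ IsManifold.maximalAtlas 𝓘(ℝ, ℂ) ∞ M) {z : ℂ} (hz : z ∈ (φ.symm.trans ψ).source) :
    gramDet (N ∘ φ.symm) z =
      planeJacobian (ψ ∘ φ.symm) z ^ 2 * gramDet (N ∘ ψ.symm) (ψ (φ.symm z)) := by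
  rw [gramDet_eq, gramDet_eq, fderiv_comp_symm hN hφ hψ hz, fderiv_comp_symm hN hφ hψ hz,
    planeJacobian]
  set A := fderiv ℝ (ψ ∘ φ.symm) z with hA
  set B := fderiv ℝ (N ∘ ψ.symm) (ψ (φ.symm z)) with hB
  rw [clm_complex_apply B (A 1), clm_complex_apply B (A Complex.I)]
  simp only [mink_add_left, mink_add_right, mink_smul_left, mink_smul_right,
    mink_comm (B Complex.I) (B 1)]
  ring

/-- A local equation of the curve in one smooth chart yields, after multiplication with the Jacobian
determinant of the coordinate change, a local equation in any other chart. -/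
theorem exists_rankDropPatch {N : M → Fin 4 → ℝ} {a : ℂ → ℂ} {Γ : Set M}
    (hN : ContMDiff 𝓘(ℝ, ℂ) 𝓘(ℝ, Fin 4 → ℝ) ∞ N) (hΓ : RankDropsTransversally N Γ)
    (hφ : φ ∈ atlas ℂ M) (ha : ∀ z ∈ φ.target, φ.symm z ∈ Γ → a z ≠ 0) {z₀ : ℂ}
    (hz₀ : z₀ ∈ φ.target) : ∃ U : Set ℂ, IsOpen U ∧ z₀ ∈ U ∧ U ⊆ φ.target ∧ ∃ (d : ℂ → ℝ) (ε : ℝ),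
      RankDropPatch U (N ∘ φ.symm) a d ε ∧ ∀ z ∈ U, φ.symm z ∈ Γ ↔ d z = 0 := by
  obtain ⟨ψ, hψ, hpψ, d, hd, hd', hdΓ, ε, hε, hdε⟩ := hΓ.defining_function (φ.symm z₀)
  have hφ' : φ ∈ IsManifold.maximalAtlas 𝓘(ℝ, ℂ) ∞ M := IsManifold.subset_maximalAtlas hφ
  set U := (φ.symm.trans ψ).source with hU
  have hUo : IsOpen U := isOpen_transition_source φ ψ
  have hUφ : U ⊆ φ.target := fun z hz => (mem_transition_source.1 hz).1
  have hUψ : ∀ z ∈ U, ψ (φ.symm z) ∈ ψ.target := fun z hz =>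
    ψ.map_source (mem_transition_source.1 hz).2
  set t := ψ ∘ φ.symm with ht
  have hts : ContDiffOn ℝ ∞ t U := contDiffOn_transition hφ' hψ
  have hJs : ContDiffOn ℝ ∞ (planeJacobian t) U := by
    have h1 := hts.fderiv_apply_const hUo 1
    have h2 := hts.fderiv_apply_const hUo Complex.I
    exact (h1.complex_re.mul h2.complex_im).sub (h1.complex_im.mul h2.complex_re)
  have hJ : ∀ z ∈ U, planeJacobian t z ≠ 0 := fun z hz =>
    planeJacobian_transition_ne_zero hφ' hψ hz
  have hdt : ContDiffOn ℝ ∞ (d ∘ t) U := hd.comp hts hUψ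
  have hzero : ∀ z ∈ U, φ.symm z ∈ Γ ↔ d (t z) * planeJacobian t z = 0 := fun z hz => by
    have h := hdΓ _ (hUψ z hz)
    rw [ψ.left_inv (mem_transition_source.1 hz).2] at h
    rw [mul_eq_zero, or_iff_left (hJ z hz), h]
    rfl
  refine ⟨U, hUo, mem_transition_source.2 ⟨hz₀, hpψ⟩, hUφ, fun z => d (t z) * planeJacobian t z, ε,
    ⟨hdt.mul hJs, hε, fun z hz => ?_, fun z hz h => ?_, fun z hz h => ?_, fun z hz h => ?_⟩, hzero⟩
  · have h1 := hdε _ (hUψ z hz)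
    rw [gramDet_comp_symm hN hφ' hψ hz, mul_pow]
    change d (ψ (φ.symm z)) ^ 2 * _ = _
    rw [h1]
    ring
  · have hdz : d (t z) = 0 := (mul_eq_zero.1 h).resolve_right (hJ z hz)
    have h1 : DifferentiableAt ℝ (fun z => d (t z)) z :=
      (hdt.contDiffAt (hUo.mem_nhds hz)).differentiableAt (by simp)
    have h2 : DifferentiableAt ℝ (planeJacobian t) z :=
      (hJs.contDiffAt (hUo.mem_nhds hz)).differentiableAt (by simp)
    rw [fderiv_fun_mul h1 h2, hdz, zero_smul, zero_add]
    refine smul_ne_zero (hJ z hz) fun h3 => hd' _ (hUψ z hz) ?_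
    have h4 : DifferentiableAt ℝ d (t z) :=
      (hd.contDiffAt (ψ.open_target.mem_nhds (hUψ z hz))).differentiableAt (by simp)
    have h5 : fderiv ℝ (fun z => d (t z)) z = (fderiv ℝ d (t z)).comp (fderiv ℝ t z) :=
      fderiv_comp z h4 (differentiableAt_transition hφ' hψ hz)
    ext v
    have hz' := transition_mem_source hz
    have h6 := fderiv_transition_comp hψ hφ' hz' v
    have h7 : φ (ψ.symm (ψ (φ.symm z))) = z := by
      rw [ψ.left_inv (mem_transition_source.1 hz).2, φ.right_inv (hUφ hz)]
    rw [h7] at h6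
    have h8 := congrArg (fun A : ℂ →L[ℝ] ℝ => A (fderiv ℝ (φ ∘ ψ.symm) (ψ (φ.symm z)) v))
      (h5.symm.trans h3)
    simp only [ContinuousLinearMap.comp_apply] at h8
    rw [ht, h6] at h8
    exact h8
  · exact ha z (hUφ hz) ((hzero z hz).2 h)
  · have h1 := hΓ.rank_le φ hφ z (hUφ hz) ((hzero z hz).2 h)
    obtain ⟨⟨e, he⟩, h2⟩ := finrank_le_one_iff.1 h1
    obtain ⟨x, hx⟩ := h2 ⟨_, LinearMap.mem_range_self _ (1 : ℂ)⟩
    obtain ⟨y, hy⟩ := h2 ⟨_, LinearMap.mem_range_self _ Complex.I⟩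
    exact ⟨e, x, y, (congrArg Subtype.val hx).symm, (congrArg Subtype.val hy).symm⟩

end Real

end Charts

/-! ### The global dual map -/

section Global

variable {M : Type*} [TopologicalSpace M] [ChartedSpace ℂ M]

/-- The point `x / x₀` of the round sphere on the line of a light-like vector `x`. -/
def sphericalPart (x : Fin 5 → ℝ) : Fin 5 → ℝ := fun i => x i / x 0

theorem sphericalPart_smul {r : ℝ} (hr : r ≠ 0) (x : Fin 5 → ℝ) :
    sphericalPart (r • x) = sphericalPart x :=
  funext fun _ => mul_div_mul_left _ _ hr

theorem affinePart_sphericalPart {x : Fin 5 → ℝ} (h0 : x 0 ≠ 0) :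
    affinePart (sphericalPart x) = affinePart x :=
  funext fun _ => div_div_div_cancel_right₀ h0 _ _

theorem sphericalPart_eq_smul (x : Fin 5 → ℝ) : sphericalPart x = (x 0)⁻¹ • x :=
  funext fun i => by simp [sphericalPart, div_eq_inv_mul]

/-- The spherical lift of the dual map off the curve, computed in the preferred chart. -/
def dualSphere (N : M → Fin 4 → ℝ) (α : OneZeroForm M) (p : M) : Fin 5 → ℝ :=
  sphericalPart (dualLiftAt (N ∘ (chartAt ℂ p).symm) (α.coeff (chartAt ℂ p)) (chartAt ℂ p p))

/-- The spherical lift of the dual map, extended across the curve `Γ` by continuity. -/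
def dualSphereExt (N : M → Fin 4 → ℝ) (α : OneZeroForm M) (Γ : Set M) : M → Fin 5 → ℝ :=
  extendFrom Γᶜ (dualSphere N α)

variable [IsManifold 𝓘(ℂ, ℂ) ω M] {N : M → Fin 4 → ℝ} {α : OneZeroForm M} {Γ : Set M}

/-- A holomorphic coordinate change with derivative `c` multiplies the dual lift by `|c|²`, so its
spherical part does not depend on the chart. -/
theorem dualSphere_eq (hN : ContMDiff 𝓘(ℝ, ℂ) 𝓘(ℝ, Fin 4 → ℝ) ∞ N)
    {φ : OpenPartialHomeomorph M ℂ} (hφ : φ ∈ atlas ℂ M) {p : M} (hp : p ∈ φ.source) :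
    dualSphere N α p = sphericalPart (dualLiftAt (N ∘ φ.symm) (α.coeff φ) (φ p)) := by
  have := isManifold_real_of_complex M
  set ψ := chartAt ℂ p with hψdef
  have hψ : ψ ∈ atlas ℂ M := chart_mem_atlas ℂ p
  have hφr : φ ∈ IsManifold.maximalAtlas 𝓘(ℝ, ℂ) ∞ M := IsManifold.subset_maximalAtlas hφ
  have hψr : ψ ∈ IsManifold.maximalAtlas 𝓘(ℝ, ℂ) ∞ M := IsManifold.subset_maximalAtlas hψ
  have hz : φ p ∈ (φ.symm.trans ψ).source := by
    rw [mem_transition_source, φ.left_inv hp]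
    exact ⟨φ.map_source hp, mem_chart_source ℂ p⟩
  have hc : DifferentiableAt ℂ (ψ ∘ φ.symm) (φ p) :=
    ((contDiffOn_transition (𝕜 := ℂ) (k := ω) (IsManifold.subset_maximalAtlas hφ)
      (IsManifold.subset_maximalAtlas hψ)).contDiffAt
      ((isOpen_transition_source φ ψ).mem_nhds hz)).differentiableAt (by simp)
  set c := deriv (ψ ∘ φ.symm) (φ p) with hcdef
  have hfd : ∀ v, fderiv ℝ (ψ ∘ φ.symm) (φ p) v = c * v := by
    intro v
    rw [hc.fderiv_restrictScalars ℝ]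
    change fderiv ℂ (ψ ∘ φ.symm) (φ p) v = c * v
    rw [hcdef, fderiv_eq_smul_deriv, smul_eq_mul, mul_comm]
  have hc0 : c ≠ 0 := by
    intro h0
    have h1 := fderiv_transition_comp hφr hψr hz 1
    rw [hfd, h0, zero_mul, map_zero] at h1
    exact zero_ne_one h1
  have hcpos : 0 < c.re ^ 2 + c.im ^ 2 := by
    have := Complex.normSq_pos.2 hc0
    rw [Complex.normSq_apply] at this
    nlinarith
  have ha : α.coeff φ (φ p) = α.coeff ψ (ψ p) * c := by
    have := α.change_coord φ hφ ψ hψ (φ p) (φ.map_source hp) (mem_transition_source.1 hz).2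
    rwa [φ.left_inv hp] at this
  have h1 : fderiv ℝ (N ∘ φ.symm) (φ p) 1 = c.re • fderiv ℝ (N ∘ ψ.symm) (ψ p) 1 +
      c.im • fderiv ℝ (N ∘ ψ.symm) (ψ p) Complex.I := by
    rw [fderiv_comp_symm hN hφr hψr hz, hfd, φ.left_inv hp, mul_one, clm_complex_apply]
  have h2 : fderiv ℝ (N ∘ φ.symm) (φ p) Complex.I = -c.im • fderiv ℝ (N ∘ ψ.symm) (ψ p) 1 +
      c.re • fderiv ℝ (N ∘ ψ.symm) (ψ p) Complex.I := by
    rw [fderiv_comp_symm hN hφr hψr hz, hfd, φ.left_inv hp, clm_complex_apply]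
    simp
  have h3 : (N ∘ φ.symm) (φ p) = N p := by simp [φ.left_inv hp]
  have h4 : (N ∘ ψ.symm) (ψ p) = N p := by simp [hψdef]
  have hsign : ∀ x : ℝ, Real.sign ((c.re ^ 2 + c.im ^ 2) * x) = Real.sign x := by
    intro x
    rcases lt_trichotomy x 0 with hx | rfl | hx
    · rw [Real.sign_of_neg hx, Real.sign_of_neg (mul_neg_of_pos_of_neg hcpos hx)]
    · rw [mul_zero]
    · rw [Real.sign_of_pos hx, Real.sign_of_pos (mul_pos hcpos hx)]
  rw [dualSphere, ← hψdef, dualLiftAt, dualLiftAt, h1, h2, ha, h3, h4, dualCodenom_change, hsign,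
    dualLift_change, sphericalPart_smul hcpos.ne']

variable (hN : ContMDiff 𝓘(ℝ, ℂ) 𝓘(ℝ, Fin 4 → ℝ) ∞ N) (hN_mem : ∀ p, N p ∈ deSitter)
  (hN_harmonic : IsHarmonicQuadricMapOn N Set.univ) (hQ : HopfEqNegSq N α)
  (hQ_ne : ∀ φ ∈ atlas ℂ M, ∀ z ∈ φ.target, φ.symm z ∈ Γ → hopf (N ∘ φ.symm) z ≠ 0)
  (hΓ : RankDropsTransversally N Γ)

include hN hN_mem hN_harmonic hQ hQ_ne hΓ

/-- Near every point, and in every chart of the atlas, the extended spherical lift is represented by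
a smooth light-like dual lift. -/
theorem exists_isDualLiftOn_chart {φ : OpenPartialHomeomorph M ℂ} (hφ : φ ∈ atlas ℂ M) {z₀ : ℂ}
    (hz₀ : z₀ ∈ φ.target) : ∃ V : Set ℂ, IsOpen V ∧ z₀ ∈ V ∧ V ⊆ φ.target ∧
      ∃ (d : ℂ → ℝ) (ε : ℝ) (L : ℂ → Fin 5 → ℝ), HarmonicPatch V (N ∘ φ.symm) (α.coeff φ) ∧
        RankDropPatch V (N ∘ φ.symm) (α.coeff φ) d ε ∧
        IsDualLiftOn V (N ∘ φ.symm) (α.coeff φ) d L ∧ (∀ z ∈ V, φ.symm z ∈ Γ ↔ d z = 0) ∧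
        ∀ z ∈ V, dualSphereExt N α Γ (φ.symm z) = sphericalPart (L z) := by
  have := isManifold_real_of_complex M
  have hφr : φ ∈ IsManifold.maximalAtlas 𝓘(ℝ, ℂ) ∞ M := IsManifold.subset_maximalAtlas hφ
  have H : HarmonicPatch φ.target (N ∘ φ.symm) (α.coeff φ) :=
    ⟨φ.open_target, contDiffOn_comp_symm hN hφr, α.smooth φ hφ, fun z _ => hN_mem _,
      fun z hz => hQ φ hφ z hz, fun z hz => hN_harmonic φ hφ z hz (Set.mem_univ _)⟩
  obtain ⟨U, hUo, hzU, hUφ, d, ε, D, hUΓ⟩ := exists_rankDropPatch (a := α.coeff φ) hN hΓ hφ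
    (fun z hz hzΓ h0 => hQ_ne φ hφ z hz hzΓ (by rw [hQ φ hφ z hz, h0]; simp)) hz₀
  obtain ⟨V, hVo, hzV, hVU, L, hL⟩ := exists_isDualLiftOn (H.mono hUo hUφ) D hzU
  have hVφ := hVU.trans hUφ
  refine ⟨V, hVo, hzV, hVφ, d, ε, L, H.mono hVo hVφ, D.mono hVU, hL,
    fun z hz => hUΓ z (hVU hz), fun z hz => ?_⟩
  have hcont := φ.continuousAt_symm (hVφ hz)
  refine extendFrom_eq (mem_closure_iff_frequently.2 fun hcon => ?_) ?_
  · have hd : d =ᶠ[nhds z] fun _ => 0 := by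
      filter_upwards [hcont.eventually hcon, hVo.mem_nhds hz] with w hw hwV
      exact (hUΓ w (hVU hwV)).1 (not_not.1 hw)
    refine D.regular z (hVU hz) hd.self_of_nhds ?_
    rw [hd.fderiv_eq]
    simp
  · have hφc : ContinuousAt φ (φ.symm z) := φ.continuousAt (φ.map_target (hVφ hz))
    have hLc : ContinuousAt (fun w => sphericalPart (L w)) z := by
      have h1 : ContinuousAt L z := hL.smooth.continuousOn.continuousAt (hVo.mem_nhds hz)
      rw [continuousAt_pi] at h1
      exact continuousAt_pi.2 fun i => (h1 i).div (h1 0) (hL.time_ne z hz)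
    have hφz : φ (φ.symm z) = z := φ.right_inv (hVφ hz)
    have h1 : Filter.Tendsto (fun q => sphericalPart (L (φ q))) (nhds (φ.symm z))
        (nhds (sphericalPart (L z))) := by
      have h2 : Filter.Tendsto (fun w => sphericalPart (L w)) (nhds (φ (φ.symm z)))
          (nhds (sphericalPart (L z))) := by rw [hφz]; exact hLc
      exact h2.comp hφc
    refine (h1.mono_left nhdsWithin_le_nhds).congr' ?_
    have hV : ∀ᶠ q in nhds (φ.symm z), φ q ∈ V :=
      hφc.eventually (by rw [hφz]; exact hVo.mem_nhds hz)
    filter_upwards [nhdsWithin_le_nhds hV, self_mem_nhdsWithin,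
      nhdsWithin_le_nhds (φ.open_source.mem_nhds (φ.map_target (hVφ hz)))] with q hqV hqΓ hqφ
    have hdq : d (φ q) ≠ 0 := fun h => hqΓ (by
      have h3 := (hUΓ _ (hVU hqV)).2 h
      rwa [φ.left_inv hqφ] at h3)
    obtain ⟨r, hr, hLr⟩ := hL.eq_smul _ hqV hdq
    rw [hLr, sphericalPart_smul hr, dualSphere_eq hN hφ hqφ]

theorem dualSphereExt_zero (p : M) : dualSphereExt N α Γ p 0 = 1 := by
  obtain ⟨V, -, hzV, -, d, ε, L, -, -, hL, -, hF⟩ := exists_isDualLiftOn_chart hN hN_mem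
    hN_harmonic hQ hQ_ne hΓ (chart_mem_atlas ℂ p) (mem_chart_target ℂ p)
  have h := hF _ hzV
  rw [(chartAt ℂ p).left_inv (mem_chart_source ℂ p)] at h
  rw [h]
  exact div_self (hL.time_ne _ hzV)

theorem dualSphereExt_mem_lightCone (p : M) : dualSphereExt N α Γ p ∈ lightCone := by
  obtain ⟨V, -, hzV, -, d, ε, L, -, -, hL, -, hF⟩ := exists_isDualLiftOn_chart hN hN_mem
    hN_harmonic hQ hQ_ne hΓ (chart_mem_atlas ℂ p) (mem_chart_target ℂ p)
  have h := hF _ hzV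
  rw [(chartAt ℂ p).left_inv (mem_chart_source ℂ p)] at h
  rw [h, sphericalPart_eq_smul]
  change mink _ _ = 0
  rw [mink_smul_left, mink_smul_right, hL.light _ hzV]
  simp

theorem contMDiff_dualSphereExt :
    ContMDiff 𝓘(ℝ, ℂ) 𝓘(ℝ, Fin 5 → ℝ) ∞ (dualSphereExt N α Γ) := by
  have := isManifold_real_of_complex M
  intro p
  set φ := chartAt ℂ p with hφ
  obtain ⟨V, hVo, hzV, -, d, ε, L, -, -, hL, -, hF⟩ := exists_isDualLiftOn_chart hN hN_mem
    hN_harmonic hQ hQ_ne hΓ (chart_mem_atlas ℂ p) (mem_chart_target ℂ p)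
  have h1 : ContMDiffAt 𝓘(ℝ, ℂ) 𝓘(ℝ, ℂ) ∞ φ p :=
    contMDiffAt_of_mem_maximalAtlas (IsManifold.chart_mem_maximalAtlas p) (mem_chart_source ℂ p)
  have h2 : ContDiffAt ℝ ∞ (fun w => sphericalPart (L w)) (φ p) := by
    have h3 := contDiffAt_pi.1 (hL.smooth.contDiffAt (hVo.mem_nhds hzV))
    exact contDiffAt_pi.2 fun i => (h3 i).div (h3 0) (hL.time_ne _ hzV)
  refine (h2.contMDiffAt.comp p h1).congr_of_eventuallyEq ?_
  have hV : ∀ᶠ q in nhds p, φ q ∈ V :=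
    (φ.continuousAt (mem_chart_source ℂ p)).eventually (hVo.mem_nhds hzV)
  filter_upwards [hV, φ.open_source.mem_nhds (mem_chart_source ℂ p)] with q hq hqφ
  have h3 := hF _ hq
  rw [φ.left_inv hqφ] at h3
  exact h3

end Global

end

theorem mainTheorem5 {M : Type*} [TopologicalSpace M] [T2Space M] [ChartedSpace ℂ M]
    [IsManifold 𝓘(ℂ, ℂ) ω M]
    (N : M → Fin 4 → ℝ) (α : OneZeroForm M) (Γ : Set M)
    (hN_smooth : ContMDiff 𝓘(ℝ, ℂ) 𝓘(ℝ, Fin 4 → ℝ) ∞ N)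
    (hN_mem : ∀ p, N p ∈ deSitter)
    (hN_harmonic : IsHarmonicQuadricMapOn N Set.univ)
    (hQ : HopfEqNegSq N α)
    (hQ_ne : ∀ φ ∈ atlas ℂ M, ∀ z ∈ φ.target, φ.symm z ∈ Γ → hopf (N ∘ φ.symm) z ≠ 0)
    (hΓ : RankDropsTransversally N Γ) :
    ∃ f : M → ProjLightCone,
      IsTransgressive f ∧ IsHarmonicProj f ∧
      {p | sphSection (f p) ∈ equatorialSphere} ⊆ Γ ∧
      IsDualMapOn N α (hypSection ∘ f) Γᶜ := by
  set F := dualSphereExt N α Γ with hFdef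
  have hF0 : ∀ p, F p 0 = 1 := dualSphereExt_zero hN_smooth hN_mem hN_harmonic hQ hQ_ne hΓ
  have hFl : ∀ p, F p ∈ lightCone :=
    dualSphereExt_mem_lightCone hN_smooth hN_mem hN_harmonic hQ hQ_ne hΓ
  have hne : ∀ p, F p ≠ 0 := fun p h => by
    have := hF0 p
    rw [h] at this
    exact zero_ne_one this
  set f : M → ProjLightCone := fun p => ProjLightCone.mk (F p) (hne p) (hFl p) with hf
  have hsph : ∀ p, sphSection (f p) = F p := fun p => by
    rw [hf, sphSection_mk]
    simp [hF0 p]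
  have hhyp : ∀ p, hypSection (f p) = affinePart (F p) := fun p => by
    rw [hf, hypSection_mk]
    rfl
  have heq : ∀ p, sphSection (f p) ∈ equatorialSphere ↔ F p 4 = 0 := fun p => by
    rw [hsph]
    exact ⟨fun h => h.2, fun h => ⟨⟨hFl p, hF0 p⟩, h⟩⟩
  have hlocal : ∀ φ ∈ atlas ℂ M, ∀ z₀ ∈ φ.target, _ := fun φ hφ z₀ hz₀ =>
    exists_isDualLiftOn_chart hN_smooth hN_mem hN_harmonic hQ hQ_ne hΓ hφ hz₀
  have hsphev : ∀ (φ : OpenPartialHomeomorph M ℂ) (V : Set ℂ) (L : ℂ → Fin 5 → ℝ), IsOpen V →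
      (∀ z ∈ V, F (φ.symm z) = sphericalPart (L z)) → ∀ z ∈ V,
      sphSection ∘ f ∘ φ.symm =ᶠ[nhds z] fun w i => L w i / L w 0 := by
    intro φ V L hV hFL z hz
    filter_upwards [hV.mem_nhds hz] with w hw
    exact (hsph _).trans (hFL w hw)
  have hhypL : ∀ (φ : OpenPartialHomeomorph M ℂ) (L : ℂ → Fin 5 → ℝ) (z : ℂ),
      F (φ.symm z) = sphericalPart (L z) → L z 0 ≠ 0 →
      hypSection (f (φ.symm z)) = affinePart (L z) := by
    intro φ L z hFL h0
    rw [hhyp, hFL, affinePart_sphericalPart h0]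
  have hF4 : ∀ (φ : OpenPartialHomeomorph M ℂ) (L : ℂ → Fin 5 → ℝ) (z : ℂ),
      F (φ.symm z) = sphericalPart (L z) → L z 0 ≠ 0 → (F (φ.symm z) 4 = 0 ↔ L z 4 = 0) := by
    intro φ L z hFL h0
    rw [hFL, sphericalPart, div_eq_zero_iff, or_iff_left h0]
  -- off the curve the hyperbolic lift is the affine part of a local dual lift
  have hoff : ∀ φ ∈ atlas ℂ M, ∀ z ∈ φ.target, φ.symm z ∉ Γ → ∃ (V : Set ℂ) (d : ℂ → ℝ) (ε : ℝ)
      (L : ℂ → Fin 5 → ℝ), z ∈ V ∧ HarmonicPatch V (N ∘ φ.symm) (α.coeff φ) ∧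
        RankDropPatch V (N ∘ φ.symm) (α.coeff φ) d ε ∧
        IsDualLiftOn V (N ∘ φ.symm) (α.coeff φ) d L ∧ d z ≠ 0 ∧ L z 4 ≠ 0 ∧
        hypSection (f (φ.symm z)) = affinePart (L z) := by
    intro φ hφ z hz hzΓ
    obtain ⟨V, -, hzV, -, d, ε, L, H, D, hL, hVΓ, hFL⟩ := hlocal φ hφ z hz
    have hdz : d z ≠ 0 := fun h => hzΓ ((hVΓ z hzV).2 h)
    exact ⟨V, d, ε, L, hzV, H, D, hL, hdz, fun h => hdz (hL.transversal z hzV h).1,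
      hhypL φ L z (hFL z hzV) (hL.time_ne z hzV)⟩
  refine ⟨f, ⟨?_, fun φ hφ z hz hzeq => ?_, fun φ hφ z hz hzeq => ?_⟩, fun φ hφ z hz hzeq => ?_,
    fun p hp => ?_, ⟨fun p hp => ?_, fun φ hφ z hz hzΓ v => ?_, fun p hp => ?_,
      fun φ hφ z hz hzΓ => ?_⟩⟩
  · have : sphSection ∘ f = F := funext hsph
    rw [IsSmoothProj, this]
    exact contMDiff_dualSphereExt hN_smooth hN_mem hN_harmonic hQ hQ_ne hΓ
  · obtain ⟨V, hVo, hzV, -, d, ε, L, H, D, hL, -, hFL⟩ := hlocal φ hφ z hz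
    have h4 := (hF4 φ L z (hFL z hzV) (hL.time_ne z hzV)).1 ((heq _).1 hzeq)
    have h1 := (hL.conformal_and_orthogonal H D hVo le_rfl hzV h4).1
    have h2 := (hsphev φ V L hVo hFL z hzV).fderiv_eq (𝕜 := ℝ)
    rw [hopf_eq] at h1 ⊢
    rw [h2, h1]
  · obtain ⟨V, hVo, hzV, -, d, ε, L, H, D, hL, -, hFL⟩ := hlocal φ hφ z hz
    have h4 := (hF4 φ L z (hFL z hzV) (hL.time_ne z hzV)).1 ((heq _).1 hzeq)
    obtain ⟨v, hv, hvw⟩ := (hL.conformal_and_orthogonal H D hVo le_rfl hzV h4).2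
    have h2 := (hsphev φ V L hVo hFL z hzV).fderiv_eq (𝕜 := ℝ)
    refine ⟨v, ?_, fun w hw => ?_⟩
    · rw [h2]; exact hv
    · rw [h2]; exact hvw w hw.2.1
  · obtain ⟨V, hVo, hzV, -, d, ε, L, H, D, hL, -, hFL⟩ := hlocal φ hφ z hz
    have h4 : L z 4 ≠ 0 := fun h => hzeq ((heq _).2
      ((hF4 φ L z (hFL z hzV) (hL.time_ne z hzV)).2 h))
    have h1 : (hypSection ∘ f) ∘ φ.symm =ᶠ[nhds z] fun w => affinePart (L w) := by
      filter_upwards [hVo.mem_nhds hzV] with w hw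
      exact hhypL φ L w (hFL w hw) (hL.time_ne w hw)
    refine ⟨-mink (Laplacian.laplacian (fun w => affinePart (L w)) z) (affinePart (L z)), ?_⟩
    rw [(InnerProductSpace.laplacian_congr_nhds h1).self_of_nhds, Function.comp_apply,
      hhypL φ L z (hFL z hzV) (hL.time_ne z hzV)]
    exact hL.laplacian_affinePart H D hzV h4
  · obtain ⟨V, -, hzV, -, d, ε, L, -, -, hL, hVΓ, hFL⟩ :=
      hlocal _ (chart_mem_atlas ℂ p) _ (mem_chart_target ℂ p)
    have hp4 : F p 4 = 0 := (heq p).1 hp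
    rw [← (chartAt ℂ p).left_inv (mem_chart_source ℂ p)] at hp4 ⊢
    have h4 := (hF4 _ L _ (hFL _ hzV) (hL.time_ne _ hzV)).1 hp4
    exact (hVΓ _ hzV).2 (hL.transversal _ hzV h4).1
  · rw [← (chartAt ℂ p).left_inv (mem_chart_source ℂ p)] at hp
    obtain ⟨V, d, ε, L, hzV, -, -, hL, -, -, hfL⟩ :=
      hoff _ (chart_mem_atlas ℂ p) _ (mem_chart_target ℂ p) hp
    have h := hL.mink_affinePart hzV
    rw [← hfL, Function.comp_apply, (chartAt ℂ p).left_inv (mem_chart_source ℂ p)] at h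
    exact h
  · obtain ⟨V, d, ε, L, hzV, -, -, hL, -, h4, hfL⟩ := hoff φ hφ z hz hzΓ
    rw [Function.comp_apply, hfL, clm_complex_apply, mink_add_left, mink_smul_left, mink_smul_left,
      hL.mink_fst_affinePart hzV h4, hL.mink_snd_affinePart hzV h4]
    apply Complex.ext
    · simp
      ring
    · simp
      ring
  · rw [← (chartAt ℂ p).left_inv (mem_chart_source ℂ p)] at hp ⊢
    obtain ⟨V, d, ε, L, hzV, -, -, hL, -, h4, hfL⟩ :=
      hoff _ (chart_mem_atlas ℂ p) _ (mem_chart_target ℂ p) hp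
    change mink (hypSection (f _)) (hypSection (f _)) = -1
    rw [hfL]
    exact hL.mink_affinePart_self hzV h4
  · obtain ⟨V, d, ε, L, hzV, H, D, hL, hdz, h4, hfL⟩ := hoff φ hφ z hz hzΓ
    rw [Function.comp_apply, hfL]
    exact hL.det_pos H D hzV hdz
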